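/- **Setup.** Let $\Bbbk$ be a field. A simply-laced Cartan datum consists of an index set $I$, a free $\mathbb{Z}$-module $X$, elements $\alpha_i,\Lambda_i\in X$ and $h_i\in \mathrm{Hom}_{\mathbb Z}(X,\mathbb{Z})$ for $i\in I$, and a bilinear form $(\cdot,\cdot)$ on $X$ (with rational values), such that $(\alpha_i,\alpha_i)=2$, $(\alpha_i,\alpha_j)=(\alpha_j,\alpha_i)\in\{0,-1\}$ for $i\ne j$, $\lambda_i:=\langle h_i,\lambda\rangle=(\alpha_i,\lambda)$ for $\lambda\in X$, and $\langle h_j,\Lambda_i\rangle=\delta_{ij}$. Put $i\cdot j=(\alpha_i,\alpha_j)$. *Parameters.* A choice of scalars $Q$ consists of $t_{ij}\in\Bbbk^\times$ for $i\neq j$ with $t_{ij}=t_{ji}$ if $i\cdot j=0$. Bubble parameters $\beta$ consist of $\beta_{i,\lambda},\mathsf c^{+}_{i,\lambda},\mathsf c^-_{i,\lambda}\in\Bbbk^\times$ for $i\in I$, $\lambda\in X$. They are compatible with $Q$ if $\mathsf c^+_{i,\lambda}\mathsf c^-_{i,\lambda}=-\beta_{i,\lambda}^{-1}$ and $\mathsf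 c^{\pm}_{i,\lambda\pm\alpha_j}=t_{ij}\,\mathsf c^{\pm}_{i,\lambda}$ for all $i,j\in I$, $\lambda \in X$, where $t_{ii}:=-\beta_{i,\lambda}$. *The 2-category.* For compatible $Q,\beta$, let $\mathcal U_{Q,\beta}(\mathfrak g)$ be the graded additive $\Bbbk$-linear 2-category with objects $\lambda\in X$; with 1-morphisms the formal finite direct sums of grading shifts $x\langle s\rangle$, $s \in \mathbb{Z}$, of composites $x$ of $\mathcal E_i\mathbb 1_\lambda:\lambda\to\lambda+\alpha_i$ and $\mathcal F_i\mathbb 1_\lambda:\lambda\to\lambda-\alpha_i$; and with 2-morphisms the matrices of $\Bbbk$-linear combinations of diagrams (a 2-morphism $x\langle s\rangle\to y\langle s'\rangle$ being a combination of diagrams $x\to y$ of degree $s'-s$) generated by dots $\mathcal E_i\mathbb 1_\lambda\to\mathcal E_i\mathbb 1_\lambda\langle 2\rangle$, crossings $\mathcal E_i\mathcal E_j\mathbb 1_\lambda\to\mathcal E_j\mathcal E_i\mathbb 1_\lambda\langle -i\cdot j\rangle$ (called $ij$-crossings), cups $\mathbb 1_\lambda\to\mathcal F_i\mathcal E_i\mathbb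 1_\lambda\langle 1+\lambda_i\rangle$ and $\mathbb 1_\lambda\to\mathcal E_i\mathcal F_i\mathbb 1_\lambda\langle 1-\lambda_i\rangle$, and caps $\mathcal F_i\mathcal E_i\mathbb 1_\lambda\to\mathbb 1_\lambda\langle 1+\lambda_i\rangle$ and $\mathcal E_i\mathcal F_i\mathbb 1_\lambda\to\mathbb 1_\lambda\langle 1-\lambda_i\rangle$, modulo the following relations. (Diagrams are read from right to left and bottom to top; we write $\psi$ for crossings.) 1. The cups and caps make $\mathcal E_i$ and $\mathcal F_i$ biadjoint (the four zigzag identities), and the two rotations of a dot, respectively of an upward crossing, by means of these cups and caps to downward strands agree. Sideways crossings $\mathcal E_i\mathcal F_j\to\mathcal F_j\mathcal E_i$ and $\mathcal F_i\mathcal E_j\to\mathcal E_j\mathcal F_i$ are defined from the crossing $\mathcal E_j\mathcal E_i\to\mathcal E_i\mathcal E_j$ by attaching one cup and one cap. 2. KLR relations on upward strands: the composite $\mathcal E_i\mathcal E_j\to\mathcal E_j\mathcal E_i\to\mathcal E_i\mathcal E_j$ of crossings is $0$ if $i=j$, $t_{ij}\,\mathrm{id}$ if $i\cdot j=0$, and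 $t_{ij}$ (dot on the $i$-strand) $+\ t_{ji}$ (dot on the $j$-strand) if $i\cdot j=-1$. If $i\neq j$, dots slide through $ij$-crossings. For $i=j$, with $x_L,x_R$ the dot on the left, respectively right, strand: $\psi x_L-x_R\psi=\mathrm{id}=x_L\psi-\psi x_R$ (vertical composites, the right-hand factor at the bottom). On $\mathcal E_i\mathcal E_j\mathcal E_k$, the composite of crossings that starts with the left pair of strands minus the one that starts with the right pair is $0$, unless $i=k$ and $i\cdot j=-1$, when it is $t_{ij}\,\mathrm{id}$. 3. For $i\ne j$ the composites of sideways crossings $\mathcal E_i\mathcal F_j\to\mathcal F_j\mathcal E_i\to\mathcal E_i\mathcal F_j$ and $\mathcal F_j\mathcal E_i\to\mathcal E_i\mathcal F_j\to\mathcal F_j\mathcal E_i$ are identities. 4. For $m\ge0$ let $b^{+}_{i,\lambda}(m)$, $b^-_{i,\lambda}(m)\in\mathrm{End}(\mathbb 1_\lambda)$ be the clockwise, respectively counterclockwise, $i$-bubble with $m$ dots, in the region $\lambda$. Then $b^{\pm}_{i,\lambda}(m)=0$ if $m<\pm\lambda_i-1$, and $b^{\pm}_{i,\lambda}(\pm\lambda_i-1)=\mathsf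 c^{\pm}_{i,\lambda}\,\mathrm{id}$ if $\pm\lambda_i\ge1$. For integers $m<0$, fake bubbles are defined by $b^\pm_{i,\lambda}(m)=0$ if $m<\pm\lambda_i-1$, $b^\pm_{i,\lambda}(\pm\lambda_i-1)=\mathsf c^\pm_{i,\lambda}\,\mathrm{id}$ if $\pm\lambda_i\le 0$, and recursively $$b^{\pm}_{i,\lambda}(\pm\lambda_i-1+n)=-\frac1{\mathsf c^{\mp}_{i,\lambda}}\sum_{y=1}^{n}b^{\pm}_{i,\lambda}(\pm\lambda_i-1+n-y)\,b^{\mp}_{i,\lambda}(\mp\lambda_i-1+y)\qquad(0<n<\mp\lambda_i+1).$$ The infinite Grassmannian relations $\sum_{x+y=n}b^+_{i,\lambda}(\lambda_i-1+x)\,b^-_{i,\lambda}(-\lambda_i-1+y)=-\delta_{n,0}\,\beta_{i,\lambda}^{-1}\,\mathrm{id}$ hold for all $n\ge0$ (sum over $x,y\ge0$). 5. $\mathfrak{sl}_2$-relations: $\mathrm{id}_{\mathcal E_i\mathcal F_i\mathbb 1_\lambda}$ equals $\beta_{i,\lambda}$ times the composite of sideways crossings $\mathcal E_i\mathcal F_i\to\mathcal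 F_i\mathcal E_i\to\mathcal E_i\mathcal F_i$ minus $\beta_{i,\lambda}$ times the sum over $f_1,f_2,f_3\geq 0$ with $f_1+f_2+f_3=\lambda_i-1$ of the cap $\mathcal E_i\mathcal F_i\to\mathbb 1_\lambda$ with $f_1$ dots, followed by $b^-_{i,\lambda}(-\lambda_i-1+f_2)$, followed by the cup $\mathbb 1_\lambda\to\mathcal E_i\mathcal F_i$ with $f_3$ dots; and $\mathrm{id}_{\mathcal F_i\mathcal E_i\mathbb 1_\lambda}$ equals $\beta_{i,\lambda}$ times the composite $\mathcal F_i\mathcal E_i\to\mathcal E_i\mathcal F_i\to\mathcal F_i\mathcal E_i$ minus $\beta_{i,\lambda}$ times the sum over $f_1+f_2+f_3=-\lambda_i-1$ of the cap $\mathcal F_i\mathcal E_i\to\mathbb 1_\lambda$ with $f_1$ dots, followed by $b^+_{i,\lambda}(\lambda_i-1+f_2)$, followed by the cup $\mathbb 1_\lambda\to\mathcal F_i\mathcal E_i$ with $f_3$ dots. (Empty sums are zero.) **Proposition.** Let $Q$ be a choice of scalars with compatible bubble parameters $\beta$, and let $D_i\in\Bbbk^\times$ for $i\in I$. Put $$\hat{\mathsf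 c}^{+}_{i,\lambda}=D_i^{-\lambda_i+1}\mathsf c^+_{i,\lambda},\quad \hat{\mathsf c}^{-}_{i,\lambda}=D_i^{\lambda_i+1}\mathsf c^-_{i,\lambda},\quad \hat\beta_{i,\lambda}=D_i^{-2}\beta_{i,\lambda},\quad \hat t_{ij}=\begin{cases}D_it_{ij}& i\cdot j=-1,\\ t_{ij}& i\cdot j=0 .\end{cases}$$ Then $\hat\beta$ is compatible with $\hat Q$, and there is an isomorphism of 2-categories (a strict $\Bbbk$-linear 2-functor with a strict inverse) $$\beth:\mathcal U_{Q,\beta}(\mathfrak g)\to\mathcal U_{\hat Q,\hat\beta}(\mathfrak g)$$ that is the identity on objects and 1-morphisms, commutes with grading shifts, sends each $i$-dot to $D_i$ times the $i$-dot and each upward $ii$-crossing to $D_i^{-1}$ times the $ii$-crossing, and fixes all upward $ij$-crossings with $i\neq j$ and all cups and caps. Moreover, for every $m\in\mathbb Z$ it sends every (real or fake) $i$-bubble with label $m$ to $D_i^{m}$ times the $i$-bubble with label $m$. -/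

import Mathlib

open CategoryTheory Bicategory

attribute [-instance] CategoryTheory.catToReflQuiver

namespace CatQG

universe u v w t

section Presentation

/-- Formal expressions for 2-morphisms of a `k`-linear strict 2-category whose 1-morphisms are those
of the category `𝒞` and whose generating 2-morphisms are `G`.  Here `f ≫ g` means first `f`, then
`g`; `wl f s` is `s` composed horizontally with the identity of `f` performed first, and `wr s h` is
`s` composed horizontally with the identity of `h` performed last. -/
inductive Term (k : Type u) {𝒞 : Type v} [Category.{w} 𝒞]
    (G : ∀ ⦃a b : 𝒞⦄, (a ⟶ b) → (a ⟶ b) → Type t) :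
    ∀ {a b : 𝒞}, (a ⟶ b) → (a ⟶ b) → Type (max u v w t)
  | gen {a b : 𝒞} {f g : a ⟶ b} (x : G f g) : Term k G f g
  | id {a b : 𝒞} (f : a ⟶ b) : Term k G f f
  | comp {a b : 𝒞} {f g h : a ⟶ b} (s : Term k G f g) (r : Term k G g h) : Term k G f h
  | wl {a b c : 𝒞} (f : a ⟶ b) {g h : b ⟶ c} (s : Term k G g h) : Term k G (f ≫ g) (f ≫ h)
  | wr {a b c : 𝒞} {f g : a ⟶ b} (s : Term k G f g) (h : b ⟶ c) : Term k G (f ≫ h) (g ≫ h)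
  | zero {a b : 𝒞} (f g : a ⟶ b) : Term k G f g
  | plus {a b : 𝒞} {f g : a ⟶ b} (s r : Term k G f g) : Term k G f g
  | smul {a b : 𝒞} {f g : a ⟶ b} (c : k) (s : Term k G f g) : Term k G f g

namespace Term

variable {k : Type u} {𝒞 : Type v} [Category.{w} 𝒞]
  {G : ∀ ⦃a b : 𝒞⦄, (a ⟶ b) → (a ⟶ b) → Type t} {a b : 𝒞}

/-- The identity 2-morphism between two equal 1-morphisms. -/
def eqTo {f g : a ⟶ b} (e : f = g) : Term k G f g := e ▸ Term.id f

/-- Vertical composition (first `s`, then `r`) along an equality of 1-morphisms that holds by the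
unit and associativity laws. -/
def vert {f g g' h : a ⟶ b} (s : Term k G f g) (r : Term k G g' h)
    (e : g = g' := by simp only [Category.assoc, Category.id_comp, Category.comp_id]) :
    Term k G f h :=
  s.comp ((eqTo e).comp r)

/-- The difference of two expressions. -/
def diff [CommRing k] {f g : a ⟶ b} (s r : Term k G f g) : Term k G f g := s.plus (r.smul (-1))

/-- The sum of a list of expressions. -/
def listSum {f g : a ⟶ b} (l : List (Term k G f g)) : Term k G f g := l.foldr plus (zero f g)

/-- `s.HasDeg deg d`: every summand of `s` has degree `d`, where generators have the degrees
prescribed by `deg` and degrees add up under vertical and horizontal composition. -/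
inductive HasDeg (deg : ∀ ⦃a b : 𝒞⦄ ⦃f g : a ⟶ b⦄, G f g → ℤ) :
    ∀ {a b : 𝒞} {f g : a ⟶ b}, Term k G f g → ℤ → Prop
  | gen {a b : 𝒞} {f g : a ⟶ b} (x : G f g) : HasDeg deg (Term.gen x) (deg x)
  | id {a b : 𝒞} (f : a ⟶ b) : HasDeg deg (Term.id f) 0
  | comp {a b : 𝒞} {f g h : a ⟶ b} {s : Term k G f g} {r : Term k G g h} {d e : ℤ} :
      HasDeg deg s d → HasDeg deg r e → HasDeg deg (s.comp r) (d + e)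
  | wl {a b c : 𝒞} (f : a ⟶ b) {g h : b ⟶ c} {s : Term k G g h} {d : ℤ} :
      HasDeg deg s d → HasDeg deg (s.wl f) d
  | wr {a b c : 𝒞} {f g : a ⟶ b} {s : Term k G f g} (h : b ⟶ c) {d : ℤ} :
      HasDeg deg s d → HasDeg deg (s.wr h) d
  | zero {a b : 𝒞} (f g : a ⟶ b) (d : ℤ) : HasDeg deg (Term.zero f g) d
  | plus {a b : 𝒞} {f g : a ⟶ b} {s r : Term k G f g} {d : ℤ} :
      HasDeg deg s d → HasDeg deg r d → HasDeg deg (s.plus r) d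
  | smul {a b : 𝒞} {f g : a ⟶ b} (c : k) {s : Term k G f g} {d : ℤ} :
      HasDeg deg s d → HasDeg deg (s.smul c) d

end Term

/-- Generators, degrees of generators, and relations for a graded `k`-linear strict 2-category with
1-morphisms those of `𝒞`. -/
structure Presentation (k : Type u) [CommRing k] (𝒞 : Type v) [Category.{w} 𝒞] where
  /-- generating 2-morphisms -/
  gen : ∀ ⦃a b : 𝒞⦄, (a ⟶ b) → (a ⟶ b) → Type t
  /-- degrees of the generating 2-morphisms -/
  deg : ∀ ⦃a b : 𝒞⦄ ⦃f g : a ⟶ b⦄, gen f g → ℤ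
  /-- defining relations -/
  rel : ∀ ⦃a b : 𝒞⦄ ⦃f g : a ⟶ b⦄, Term k gen f g → Term k gen f g → Prop

variable {k : Type u} [CommRing k] {𝒞 : Type v} [Category.{w} 𝒞]

/-- The smallest congruence on formal 2-morphisms that contains the defining relations and the
axioms of a `k`-linear strict 2-category. -/
inductive Presentation.Cong (T : Presentation.{u, v, w, t} k 𝒞) :
    ∀ {a b : 𝒞} {f g : a ⟶ b}, Term k T.gen f g → Term k T.gen f g → Prop
  -- the defining relations
  | of {a b : 𝒞} {f g : a ⟶ b} {s r : Term k T.gen f g} : T.rel s r → Cong T s r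
  -- equivalence relation
  | refl {a b : 𝒞} {f g : a ⟶ b} (s : Term k T.gen f g) : Cong T s s
  | symm {a b : 𝒞} {f g : a ⟶ b} {s r : Term k T.gen f g} : Cong T s r → Cong T r s
  | trans {a b : 𝒞} {f g : a ⟶ b} {s r q : Term k T.gen f g} :
      Cong T s r → Cong T r q → Cong T s q
  -- compatibility with the operations
  | comp_congr {a b : 𝒞} {f g h : a ⟶ b} {s s' : Term k T.gen f g} {r r' : Term k T.gen g h} :
      Cong T s s' → Cong T r r' → Cong T (s.comp r) (s'.comp r')
  | wl_congr {a b c : 𝒞} (f : a ⟶ b) {g h : b ⟶ c} {s s' : Term k T.gen g h} :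
      Cong T s s' → Cong T (s.wl f) (s'.wl f)
  | wr_congr {a b c : 𝒞} {f g : a ⟶ b} (h : b ⟶ c) {s s' : Term k T.gen f g} :
      Cong T s s' → Cong T (s.wr h) (s'.wr h)
  | plus_congr {a b : 𝒞} {f g : a ⟶ b} {s s' r r' : Term k T.gen f g} :
      Cong T s s' → Cong T r r' → Cong T (s.plus r) (s'.plus r')
  | smul_congr {a b : 𝒞} {f g : a ⟶ b} (c : k) {s s' : Term k T.gen f g} :
      Cong T s s' → Cong T (s.smul c) (s'.smul c)
  -- `k`-modules of 2-morphisms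
  | plus_comm {a b : 𝒞} {f g : a ⟶ b} (s r : Term k T.gen f g) : Cong T (s.plus r) (r.plus s)
  | plus_assoc {a b : 𝒞} {f g : a ⟶ b} (s r q : Term k T.gen f g) :
      Cong T ((s.plus r).plus q) (s.plus (r.plus q))
  | zero_plus {a b : 𝒞} {f g : a ⟶ b} (s : Term k T.gen f g) : Cong T ((Term.zero f g).plus s) s
  | neg_plus {a b : 𝒞} {f g : a ⟶ b} (s : Term k T.gen f g) :
      Cong T ((s.smul (-1)).plus s) (Term.zero f g)
  | smul_plus {a b : 𝒞} {f g : a ⟶ b} (c : k) (s r : Term k T.gen f g) :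
      Cong T ((s.plus r).smul c) ((s.smul c).plus (r.smul c))
  | plus_smul {a b : 𝒞} {f g : a ⟶ b} (c d : k) (s : Term k T.gen f g) :
      Cong T (s.smul (c + d)) ((s.smul c).plus (s.smul d))
  | mul_smul {a b : 𝒞} {f g : a ⟶ b} (c d : k) (s : Term k T.gen f g) :
      Cong T (s.smul (c * d)) ((s.smul d).smul c)
  | one_smul {a b : 𝒞} {f g : a ⟶ b} (s : Term k T.gen f g) : Cong T (s.smul 1) s
  -- compositions are bilinear
  | plus_comp {a b : 𝒞} {f g h : a ⟶ b} (s s' : Term k T.gen f g) (r : Term k T.gen g h) :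
      Cong T ((s.plus s').comp r) ((s.comp r).plus (s'.comp r))
  | comp_plus {a b : 𝒞} {f g h : a ⟶ b} (s : Term k T.gen f g) (r r' : Term k T.gen g h) :
      Cong T (s.comp (r.plus r')) ((s.comp r).plus (s.comp r'))
  | smul_comp {a b : 𝒞} {f g h : a ⟶ b} (c : k) (s : Term k T.gen f g) (r : Term k T.gen g h) :
      Cong T ((s.smul c).comp r) ((s.comp r).smul c)
  | comp_smul {a b : 𝒞} {f g h : a ⟶ b} (c : k) (s : Term k T.gen f g) (r : Term k T.gen g h) :
      Cong T (s.comp (r.smul c)) ((s.comp r).smul c)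
  | wl_plus {a b c : 𝒞} (f : a ⟶ b) {g h : b ⟶ c} (s r : Term k T.gen g h) :
      Cong T ((s.plus r).wl f) ((s.wl f).plus (r.wl f))
  | wl_smul {a b c : 𝒞} (f : a ⟶ b) {g h : b ⟶ c} (x : k) (s : Term k T.gen g h) :
      Cong T ((s.smul x).wl f) ((s.wl f).smul x)
  | plus_wr {a b c : 𝒞} {f g : a ⟶ b} (h : b ⟶ c) (s r : Term k T.gen f g) :
      Cong T ((s.plus r).wr h) ((s.wr h).plus (r.wr h))
  | smul_wr {a b c : 𝒞} {f g : a ⟶ b} (h : b ⟶ c) (x : k) (s : Term k T.gen f g) :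
      Cong T ((s.smul x).wr h) ((s.wr h).smul x)
  -- vertical composition
  | id_comp {a b : 𝒞} {f g : a ⟶ b} (s : Term k T.gen f g) : Cong T ((Term.id f).comp s) s
  | comp_id {a b : 𝒞} {f g : a ⟶ b} (s : Term k T.gen f g) : Cong T (s.comp (Term.id g)) s
  | assoc {a b : 𝒞} {f g h i : a ⟶ b} (s : Term k T.gen f g) (r : Term k T.gen g h)
      (q : Term k T.gen h i) : Cong T ((s.comp r).comp q) (s.comp (r.comp q))
  -- horizontal composition is functorial
  | wl_id {a b c : 𝒞} (f : a ⟶ b) (g : b ⟶ c) : Cong T ((Term.id g).wl f) (Term.id (f ≫ g))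
  | wl_comp {a b c : 𝒞} (f : a ⟶ b) {g h i : b ⟶ c} (s : Term k T.gen g h)
      (r : Term k T.gen h i) : Cong T ((s.comp r).wl f) ((s.wl f).comp (r.wl f))
  | id_wr {a b c : 𝒞} (f : a ⟶ b) (g : b ⟶ c) : Cong T ((Term.id f).wr g) (Term.id (f ≫ g))
  | comp_wr {a b c : 𝒞} {f g h : a ⟶ b} (s : Term k T.gen f g) (r : Term k T.gen g h)
      (i : b ⟶ c) : Cong T ((s.comp r).wr i) ((s.wr i).comp (r.wr i))
  | exchange {a b c : 𝒞} {f g : a ⟶ b} {h i : b ⟶ c} (s : Term k T.gen f g)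
      (r : Term k T.gen h i) : Cong T ((r.wl f).comp (s.wr i)) ((s.wr h).comp (r.wl g))
  -- horizontal composition is strictly unital and associative
  | id_wl {a b : 𝒞} {f g : a ⟶ b} (s : Term k T.gen f g) :
      Cong T (s.wl (𝟙 a))
        ((Term.eqTo (Category.id_comp f)).comp (s.comp (Term.eqTo (Category.id_comp g).symm)))
  | wr_id {a b : 𝒞} {f g : a ⟶ b} (s : Term k T.gen f g) :
      Cong T (s.wr (𝟙 b))
        ((Term.eqTo (Category.comp_id f)).comp (s.comp (Term.eqTo (Category.comp_id g).symm)))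
  | wl_wl {a b c d : 𝒞} (f : a ⟶ b) (g : b ⟶ c) {h i : c ⟶ d} (s : Term k T.gen h i) :
      Cong T (s.wl (f ≫ g))
        ((Term.eqTo (Category.assoc f g h)).comp
          (((s.wl g).wl f).comp (Term.eqTo (Category.assoc f g i).symm)))
  | wr_wr {a b c d : 𝒞} {f f' : a ⟶ b} (s : Term k T.gen f f') (g : b ⟶ c) (h : c ⟶ d) :
      Cong T (s.wr (g ≫ h))
        ((Term.eqTo (Category.assoc f g h).symm).comp
          (((s.wr g).wr h).comp (Term.eqTo (Category.assoc f' g h))))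
  | wl_wr {a b c d : 𝒞} (f : a ⟶ b) {g g' : b ⟶ c} (s : Term k T.gen g g') (h : c ⟶ d) :
      Cong T ((s.wl f).wr h)
        ((Term.eqTo (Category.assoc f g h)).comp
          (((s.wr h).wl f).comp (Term.eqTo (Category.assoc f g' h).symm)))

/-- The objects of the strict 2-category presented by `T`. -/
structure Presentation.Star (T : Presentation.{u, v, w, t} k 𝒞) where
  /-- the underlying object of `𝒞` -/
  as : 𝒞

namespace Presentation.Star

variable {T : Presentation.{u, v, w, t} k 𝒞}

/-- 1-morphisms are those of `𝒞`. -/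
@[reducible] def oneCat (T : Presentation.{u, v, w, t} k 𝒞) : CategoryStruct.{w} T.Star where
  Hom a b := a.as ⟶ b.as
  id a := 𝟙 a.as
  comp f g := f ≫ g

/-- 2-morphisms: formal expressions modulo the congruence. -/
def TwoHom (T : Presentation.{u, v, w, t} k 𝒞) {a b : 𝒞} (f g : a ⟶ b) : Type (max u v w t) :=
  Quot (T.Cong (f := f) (g := g))

/-- The class of a formal expression. -/
def cls {a b : 𝒞} {f g : a ⟶ b} (s : Term k T.gen f g) : TwoHom T f g := Quot.mk _ s

theorem sound {a b : 𝒞} {f g : a ⟶ b} {s r : Term k T.gen f g} (h : T.Cong s r) :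
    cls s = cls r := Quot.sound h

instance {a b : 𝒞} (f g : a ⟶ b) : Zero (TwoHom T f g) := ⟨cls (Term.zero f g)⟩

instance {a b : 𝒞} (f g : a ⟶ b) : Add (TwoHom T f g) :=
  ⟨fun s r => Quot.map₂ Term.plus (fun _ _ _ h => .plus_congr (.refl _) h)
    (fun _ _ _ h => .plus_congr h (.refl _)) s r⟩

instance {a b : 𝒞} (f g : a ⟶ b) : Neg (TwoHom T f g) :=
  ⟨fun s => Quot.map (Term.smul (-1)) (fun _ _ h => .smul_congr _ h) s⟩

instance {a b : 𝒞} (f g : a ⟶ b) : AddCommGroup (TwoHom T f g) where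
  add_assoc := by rintro ⟨s⟩ ⟨r⟩ ⟨q⟩; exact sound (.plus_assoc s r q)
  add_comm := by rintro ⟨s⟩ ⟨r⟩; exact sound (.plus_comm s r)
  zero_add := by rintro ⟨s⟩; exact sound (.zero_plus s)
  add_zero := by rintro ⟨s⟩; exact sound (.trans (.plus_comm _ _) (.zero_plus s))
  neg_add_cancel := by rintro ⟨s⟩; exact sound (.neg_plus s)
  nsmul := nsmulRec
  zsmul := zsmulRec

instance {a b : 𝒞} (f g : a ⟶ b) : Module k (TwoHom T f g) :=
  letI : SMul k (TwoHom T f g) :=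
    ⟨fun c s => Quot.map (Term.smul c) (fun _ _ h => .smul_congr _ h) s⟩
  Module.ofMinimalAxioms
    (by rintro c ⟨s⟩ ⟨r⟩; exact sound (.smul_plus c s r))
    (by rintro c d ⟨s⟩; exact sound (.plus_smul c d s))
    (by rintro c d ⟨s⟩; exact sound (.mul_smul c d s))
    (by rintro ⟨s⟩; exact sound (.one_smul s))

section Setup

attribute [local instance] oneCat

/-- Vertical composition. -/
@[reducible] def homCat (a b : T.Star) : Category.{max u v w t} (a ⟶ b) where
  Hom f g := TwoHom T (a := a.as) (b := b.as) f g
  id f := cls (Term.id (a := a.as) (b := b.as) f)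
  comp s r := Quot.map₂ Term.comp (fun _ _ _ h => .comp_congr (.refl _) h)
    (fun _ _ _ h => .comp_congr h (.refl _)) s r
  id_comp := by rintro f g ⟨s⟩; exact sound (.id_comp s)
  comp_id := by rintro f g ⟨s⟩; exact sound (.comp_id s)
  assoc := by rintro f g h i ⟨s⟩ ⟨r⟩ ⟨q⟩; exact sound (.assoc s r q)

attribute [local instance] homCat

theorem cls_eqTo {a b : T.Star} {f g : a ⟶ b} (e : f = g) :
    (cls (T := T) (Term.eqTo (a := a.as) (b := b.as) (f := f) (g := g) e) : f ⟶ g) =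
      eqToHom e := by
  subst e; rfl

theorem hom_assoc {a b c d : T.Star} (f : a ⟶ b) (g : b ⟶ c) (h : c ⟶ d) :
    (f ≫ g) ≫ h = f ≫ g ≫ h := Category.assoc (obj := 𝒞) f g h

theorem hom_id_comp {a b : T.Star} (f : a ⟶ b) : 𝟙 a ≫ f = f := Category.id_comp (obj := 𝒞) f

theorem hom_comp_id {a b : T.Star} (f : a ⟶ b) : f ≫ 𝟙 b = f := Category.comp_id (obj := 𝒞) f

/-- Horizontal composition with an identity 2-morphism performed first. -/
def wL {a b c : T.Star} (f : a ⟶ b) {g h : b ⟶ c} (s : g ⟶ h) : f ≫ g ⟶ f ≫ h :=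
  Quot.map (Term.wl (a := a.as) (b := b.as) (c := c.as) f) (fun _ _ h => .wl_congr _ h) s

/-- Horizontal composition with an identity 2-morphism performed last. -/
def wR {a b c : T.Star} {f g : a ⟶ b} (s : f ⟶ g) (h : b ⟶ c) : f ≫ h ⟶ g ≫ h :=
  Quot.map (fun s => Term.wr (a := a.as) (b := b.as) (c := c.as) s h)
    (fun _ _ h => .wr_congr _ h) s

theorem wL_eqToHom {a b c : T.Star} (f : a ⟶ b) {g h : b ⟶ c} (e : g = h) :
    wL f (eqToHom e) = eqToHom (by rw [e]) := by
  subst e; exact sound (.wl_id (a := a.as) (b := b.as) (c := c.as) f g)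

theorem wR_eqToHom {a b c : T.Star} {f g : a ⟶ b} (e : f = g) (h : b ⟶ c) :
    wR (eqToHom e) h = eqToHom (by rw [e]) := by
  subst e; exact sound (.id_wr (a := a.as) (b := b.as) (c := c.as) f h)

/-- The strict 2-category presented by `T`, with 2-morphisms of all degrees. -/
instance instBicategory : Bicategory.{max u v w t} T.Star where
  toCategoryStruct := oneCat T
  homCategory := homCat
  whiskerLeft := wL
  whiskerRight := wR
  associator f g h := eqToIso (hom_assoc f g h)
  leftUnitor f := eqToIso (hom_id_comp f)
  rightUnitor f := eqToIso (hom_comp_id f)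
  whiskerLeft_id {a b c} f g := sound (.wl_id (a := a.as) (b := b.as) (c := c.as) f g)
  whiskerLeft_comp := by
    rintro a b c f g h i ⟨s⟩ ⟨r⟩
    exact sound (.wl_comp (a := a.as) (b := b.as) (c := c.as) f s r)
  id_whiskerLeft := by
    rintro a b f g ⟨s⟩
    refine (sound (.id_wl (a := a.as) (b := b.as) s)).trans ?_
    rw [eqToIso.hom, eqToIso.inv, ← cls_eqTo, ← cls_eqTo]; rfl
  comp_whiskerLeft := by
    rintro a b c d f g h h' ⟨s⟩
    refine (sound (.wl_wl (a := a.as) (b := b.as) (c := c.as) (d := d.as) f g s)).trans ?_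
    rw [eqToIso.hom, eqToIso.inv, ← cls_eqTo, ← cls_eqTo]; rfl
  id_whiskerRight {a b c} f g := sound (.id_wr (a := a.as) (b := b.as) (c := c.as) f g)
  comp_whiskerRight := by
    rintro a b c f g h ⟨s⟩ ⟨r⟩ i
    exact sound (.comp_wr (a := a.as) (b := b.as) (c := c.as) s r i)
  whiskerRight_id := by
    rintro a b f g ⟨s⟩
    refine (sound (.wr_id (a := a.as) (b := b.as) s)).trans ?_
    rw [eqToIso.hom, eqToIso.inv, ← cls_eqTo, ← cls_eqTo]; rfl
  whiskerRight_comp := by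
    rintro a b c d f f' ⟨s⟩ g h
    refine (sound (.wr_wr (a := a.as) (b := b.as) (c := c.as) (d := d.as) s g h)).trans ?_
    rw [eqToIso.hom, eqToIso.inv, ← cls_eqTo, ← cls_eqTo]; rfl
  whisker_assoc := by
    rintro a b c d f g g' ⟨s⟩ h
    refine (sound (.wl_wr (a := a.as) (b := b.as) (c := c.as) (d := d.as) f s h)).trans ?_
    rw [eqToIso.hom, eqToIso.inv, ← cls_eqTo, ← cls_eqTo]; rfl
  whisker_exchange := by
    rintro a b c f g h i ⟨s⟩ ⟨r⟩
    exact sound (.exchange (a := a.as) (b := b.as) (c := c.as) s r)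
  pentagon f g h i := by
    simp only [eqToIso.hom, wL_eqToHom, wR_eqToHom, eqToHom_trans]
  triangle f g := by
    simp only [eqToIso.hom, wL_eqToHom, wR_eqToHom, eqToHom_trans]

end Setup

instance (a b : T.Star) : Preadditive (a ⟶ b) where
  homGroup f g := inferInstanceAs (AddCommGroup (TwoHom T (a := a.as) (b := b.as) f g))
  add_comp := by rintro f g h ⟨s⟩ ⟨s'⟩ ⟨r⟩; exact sound (.plus_comp s s' r)
  comp_add := by rintro f g h ⟨s⟩ ⟨r⟩ ⟨r'⟩; exact sound (.comp_plus s r r')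

instance (a b : T.Star) : Linear k (a ⟶ b) where
  homModule f g := inferInstanceAs (Module k (TwoHom T (a := a.as) (b := b.as) f g))
  smul_comp := by rintro f g h c ⟨s⟩ ⟨r⟩; exact sound (.smul_comp c s r)
  comp_smul := by rintro f g h ⟨s⟩ c ⟨r⟩; exact sound (.comp_smul c s r)

theorem whiskerLeft_add {a b c : T.Star} (f : a ⟶ b) {g h : b ⟶ c} (s r : g ⟶ h) :
    f ◁ (s + r) = f ◁ s + f ◁ r := by
  obtain ⟨s⟩ := s; obtain ⟨r⟩ := r
  exact sound (.wl_plus (a := a.as) (b := b.as) (c := c.as) f s r)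

theorem whiskerLeft_smul {a b c : T.Star} (f : a ⟶ b) {g h : b ⟶ c} (x : k) (s : g ⟶ h) :
    f ◁ (x • s) = x • (f ◁ s) := by
  obtain ⟨s⟩ := s
  exact sound (.wl_smul (a := a.as) (b := b.as) (c := c.as) f x s)

theorem add_whiskerRight {a b c : T.Star} {f g : a ⟶ b} (s r : f ⟶ g) (h : b ⟶ c) :
    (s + r) ▷ h = s ▷ h + r ▷ h := by
  obtain ⟨s⟩ := s; obtain ⟨r⟩ := r
  exact sound (.plus_wr (a := a.as) (b := b.as) (c := c.as) h s r)

theorem smul_whiskerRight {a b c : T.Star} {f g : a ⟶ b} (x : k) (s : f ⟶ g) (h : b ⟶ c) :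
    (x • s) ▷ h = x • (s ▷ h) := by
  obtain ⟨s⟩ := s
  exact sound (.smul_wr (a := a.as) (b := b.as) (c := c.as) h x s)

theorem whiskerLeft_zero {a b c : T.Star} (f : a ⟶ b) (g h : b ⟶ c) :
    f ◁ (0 : g ⟶ h) = 0 := by
  simpa using whiskerLeft_smul f (0 : k) (0 : g ⟶ h)

theorem zero_whiskerRight {a b c : T.Star} (f g : a ⟶ b) (h : b ⟶ c) :
    (0 : f ⟶ g) ▷ h = 0 := by
  simpa using smul_whiskerRight (0 : k) (0 : f ⟶ g) h

theorem whiskerLeft_sum {a b c : T.Star} {ι : Type} [Fintype ι] (f : a ⟶ b) {g h : b ⟶ c}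
    (s : ι → (g ⟶ h)) : f ◁ (∑ i, s i) = ∑ i, f ◁ s i :=
  map_sum (AddMonoidHom.mk' (fun s : g ⟶ h => f ◁ s) (whiskerLeft_add f)) s Finset.univ

theorem sum_whiskerRight {a b c : T.Star} {ι : Type} [Fintype ι] {f g : a ⟶ b}
    (s : ι → (f ⟶ g)) (h : b ⟶ c) : (∑ i, s i) ▷ h = ∑ i, s i ▷ h :=
  map_sum (AddMonoidHom.mk' (fun s : f ⟶ g => s ▷ h) (add_whiskerRight · · h)) s Finset.univ

/-- The 2-morphisms of degree `d`. -/
def homog {a b : T.Star} (f g : a ⟶ b) (d : ℤ) : Submodule k (f ⟶ g) where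
  carrier := {q | ∃ s : Term k T.gen (a := a.as) (b := b.as) f g, s.HasDeg T.deg d ∧ cls s = q}
  add_mem' := by
    rintro _ _ ⟨s, hs, rfl⟩ ⟨r, hr, rfl⟩
    exact ⟨s.plus r, hs.plus hr, rfl⟩
  zero_mem' := ⟨Term.zero _ _, .zero _ _ d, rfl⟩
  smul_mem' := by
    rintro c _ ⟨s, hs, rfl⟩
    exact ⟨s.smul c, hs.smul c, rfl⟩

theorem id_mem {a b : T.Star} (f : a ⟶ b) : 𝟙 f ∈ homog f f 0 := ⟨_, .id _, rfl⟩

theorem comp_mem {a b : T.Star} {f g h : a ⟶ b} {s : f ⟶ g} {r : g ⟶ h} {d e : ℤ}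
    (hs : s ∈ homog f g d) (hr : r ∈ homog g h e) : s ≫ r ∈ homog f h (d + e) := by
  obtain ⟨s, hs, rfl⟩ := hs; obtain ⟨r, hr, rfl⟩ := hr
  exact ⟨s.comp r, hs.comp hr, rfl⟩

theorem whiskerLeft_mem {a b c : T.Star} (f : a ⟶ b) {g h : b ⟶ c} {s : g ⟶ h} {d : ℤ}
    (hs : s ∈ homog g h d) : f ◁ s ∈ homog (f ≫ g) (f ≫ h) d := by
  obtain ⟨s, hs, rfl⟩ := hs
  exact ⟨_, hs.wl _, rfl⟩

theorem whiskerRight_mem {a b c : T.Star} {f g : a ⟶ b} {s : f ⟶ g} (h : b ⟶ c) {d : ℤ}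
    (hs : s ∈ homog f g d) : s ▷ h ∈ homog (f ≫ h) (g ≫ h) d := by
  obtain ⟨s, hs, rfl⟩ := hs
  exact ⟨_, hs.wr _, rfl⟩

theorem eqToHom_mem {a b : T.Star} {f g : a ⟶ b} (e : f = g) : eqToHom e ∈ homog f g 0 := by
  subst e; exact id_mem f

end Presentation.Star

/-- The objects of the graded additive 2-category presented by `T`. -/
structure Presentation.Env (T : Presentation.{u, v, w, t} k 𝒞) where
  /-- the underlying object -/
  base : T.Star

namespace Presentation.Env

variable {T : Presentation.{u, v, w, t} k 𝒞}

/-- 1-morphisms: formal finite direct sums of 1-morphisms `word i` of `𝒞`, each shifted by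
`shift i`. -/
structure OneMor (a b : T.Env) where
  /-- index set of the summands -/
  ι : Type
  [fintype : Fintype ι]
  /-- the summands -/
  word : ι → (a.base ⟶ b.base)
  /-- the grading shifts of the summands -/
  shift : ι → ℤ

attribute [instance] OneMor.fintype

/-- 2-morphisms: matrices of 2-morphisms between the summands; a 2-morphism from `f⟨m⟩` to `g⟨n⟩`
is a 2-morphism of degree `n - m` from `f` to `g`. -/
@[ext]
structure TwoMor {a b : T.Env} (x y : OneMor a b) where
  /-- the matrix entries -/
  entry : ∀ (i : x.ι) (j : y.ι), x.word i ⟶ y.word j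
  mem : ∀ i j, entry i j ∈ Star.homog (x.word i) (y.word j) (y.shift j - x.shift i)

namespace TwoMor

variable {a b : T.Env}

instance (x y : OneMor a b) : Zero (TwoMor x y) := ⟨⟨fun _ _ => 0, fun _ _ => zero_mem _⟩⟩

instance (x y : OneMor a b) : Add (TwoMor x y) :=
  ⟨fun s r => ⟨fun i j => s.entry i j + r.entry i j, fun i j => add_mem (s.mem i j) (r.mem i j)⟩⟩

instance (x y : OneMor a b) : Neg (TwoMor x y) :=
  ⟨fun s => ⟨fun i j => -s.entry i j, fun i j => neg_mem (s.mem i j)⟩⟩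

instance (x y : OneMor a b) : SMul k (TwoMor x y) :=
  ⟨fun c s => ⟨fun i j => c • s.entry i j, fun i j => Submodule.smul_mem _ c (s.mem i j)⟩⟩

@[simp] theorem zero_entry (x y : OneMor a b) (i : x.ι) (j : y.ι) :
    (0 : TwoMor x y).entry i j = 0 := rfl

@[simp] theorem add_entry {x y : OneMor a b} (s r : TwoMor x y) (i : x.ι) (j : y.ι) :
    (s + r).entry i j = s.entry i j + r.entry i j := rfl

@[simp] theorem neg_entry {x y : OneMor a b} (s : TwoMor x y) (i : x.ι) (j : y.ι) :
    (-s).entry i j = -s.entry i j := rfl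

@[simp] theorem smul_entry {x y : OneMor a b} (c : k) (s : TwoMor x y) (i : x.ι) (j : y.ι) :
    (c • s).entry i j = c • s.entry i j := rfl

instance (x y : OneMor a b) : AddCommGroup (TwoMor x y) where
  add_assoc s r q := by ext; simp [add_assoc]
  add_comm s r := by ext; simp [add_comm]
  zero_add s := by ext; simp
  add_zero s := by ext; simp
  neg_add_cancel s := by ext; simp
  nsmul := nsmulRec
  zsmul := zsmulRec

instance (x y : OneMor a b) : Module k (TwoMor x y) :=
  Module.ofMinimalAxioms
    (fun c s r => by ext; simp [smul_add])
    (fun c d s => by ext; simp [add_smul])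
    (fun c d s => by ext; simp [mul_smul])
    (fun s => by ext; simp)

/-- Matrix multiplication. -/
def comp {x y z : OneMor a b} (s : TwoMor x y) (r : TwoMor y z) : TwoMor x z where
  entry i l := ∑ j, s.entry i j ≫ r.entry j l
  mem i l := sum_mem fun j _ => by
    have := Star.comp_mem (s.mem i j) (r.mem j l)
    rwa [sub_add_sub_cancel'] at this

@[simp] theorem comp_entry {x y z : OneMor a b} (s : TwoMor x y) (r : TwoMor y z) (i : x.ι)
    (l : z.ι) : (s.comp r).entry i l = ∑ j, s.entry i j ≫ r.entry j l := rfl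

open scoped Classical in
/-- The matrix with entries `θ i` in the places `(i, σ i)` and zeros elsewhere. -/
noncomputable def mono {x y : OneMor a b} (σ : x.ι ≃ y.ι) (θ : ∀ i, x.word i ⟶ y.word (σ i))
    (hθ : ∀ i, θ i ∈ Star.homog _ _ (y.shift (σ i) - x.shift i)) : TwoMor x y where
  entry i j := if h : σ i = j then θ i ≫ eqToHom (congrArg y.word h) else 0
  mem i j := by
    split_ifs with h
    · subst h; simpa using hθ i
    · exact zero_mem _

theorem mono_entry_self {x y : OneMor a b} (σ : x.ι ≃ y.ι) (θ : ∀ i, x.word i ⟶ y.word (σ i))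
    (hθ : ∀ i, θ i ∈ Star.homog _ _ (y.shift (σ i) - x.shift i)) (i : x.ι) :
    (mono σ θ hθ).entry i (σ i) = θ i := by simp [mono]

theorem mono_entry_ne {x y : OneMor a b} (σ : x.ι ≃ y.ι) (θ : ∀ i, x.word i ⟶ y.word (σ i))
    (hθ : ∀ i, θ i ∈ Star.homog _ _ (y.shift (σ i) - x.shift i)) {i : x.ι} {j : y.ι}
    (h : σ i ≠ j) : (mono σ θ hθ).entry i j = 0 := by simp [mono, h]

theorem mono_comp_entry {x y z : OneMor a b} (σ : x.ι ≃ y.ι)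
    (θ : ∀ i, x.word i ⟶ y.word (σ i))
    (hθ : ∀ i, θ i ∈ Star.homog _ _ (y.shift (σ i) - x.shift i)) (r : TwoMor y z) (i : x.ι)
    (l : z.ι) : ((mono σ θ hθ).comp r).entry i l = θ i ≫ r.entry (σ i) l := by
  rw [comp_entry, Finset.sum_eq_single (σ i), mono_entry_self]
  · intro j _ hj
    rw [mono_entry_ne _ _ _ hj.symm, Limits.zero_comp]
  · simp

theorem comp_mono_entry {x y z : OneMor a b} (s : TwoMor x y) (σ : y.ι ≃ z.ι)
    (θ : ∀ i, y.word i ⟶ z.word (σ i))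
    (hθ : ∀ i, θ i ∈ Star.homog _ _ (z.shift (σ i) - y.shift i)) (i : x.ι)
    (j : y.ι) : (s.comp (mono σ θ hθ)).entry i (σ j) = s.entry i j ≫ θ j := by
  rw [comp_entry, Finset.sum_eq_single j, mono_entry_self]
  · intro j' _ hj
    rw [mono_entry_ne _ _ _ (fun h => hj (σ.injective h)), Limits.comp_zero]
  · simp

open scoped Classical in
/-- The matrix with entries `θ i` in the places `(σ i, i)` and zeros elsewhere. -/
noncomputable def comono {x y : OneMor a b} (σ : x.ι ≃ y.ι) (θ : ∀ i, y.word (σ i) ⟶ x.word i)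
    (hθ : ∀ i, θ i ∈ Star.homog _ _ (x.shift i - y.shift (σ i))) : TwoMor y x where
  entry j i := if h : σ i = j then eqToHom (congrArg y.word h.symm) ≫ θ i else 0
  mem j i := by
    split_ifs with h
    · subst h; simpa using hθ i
    · exact zero_mem _

theorem comono_entry_self {x y : OneMor a b} (σ : x.ι ≃ y.ι) (θ : ∀ i, y.word (σ i) ⟶ x.word i)
    (hθ : ∀ i, θ i ∈ Star.homog _ _ (x.shift i - y.shift (σ i))) (i : x.ι) :
    (comono σ θ hθ).entry (σ i) i = θ i := by simp [comono]

theorem comono_entry_ne {x y : OneMor a b} (σ : x.ι ≃ y.ι) (θ : ∀ i, y.word (σ i) ⟶ x.word i)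
    (hθ : ∀ i, θ i ∈ Star.homog _ _ (x.shift i - y.shift (σ i))) {i : x.ι} {j : y.ι}
    (h : σ i ≠ j) : (comono σ θ hθ).entry j i = 0 := by simp [comono, h]

theorem comp_comono_entry {x y z : OneMor a b} (s : TwoMor z y) (σ : x.ι ≃ y.ι)
    (θ : ∀ i, y.word (σ i) ⟶ x.word i)
    (hθ : ∀ i, θ i ∈ Star.homog _ _ (x.shift i - y.shift (σ i))) (l : z.ι) (i : x.ι) :
    (s.comp (comono σ θ hθ)).entry l i = s.entry l (σ i) ≫ θ i := by
  rw [comp_entry, Finset.sum_eq_single (σ i), comono_entry_self]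
  · intro j _ hj
    rw [comono_entry_ne _ _ _ hj.symm, Limits.comp_zero]
  · simp

theorem comono_comp_entry {x y z : OneMor a b} (σ : x.ι ≃ y.ι)
    (θ : ∀ i, y.word (σ i) ⟶ x.word i)
    (hθ : ∀ i, θ i ∈ Star.homog _ _ (x.shift i - y.shift (σ i))) (r : TwoMor x z) (i : x.ι)
    (l : z.ι) : ((comono σ θ hθ).comp r).entry (σ i) l = θ i ≫ r.entry i l := by
  rw [comp_entry, Finset.sum_eq_single i, comono_entry_self]
  · intro j _ hj
    rw [comono_entry_ne _ _ _ (fun h => hj (σ.injective h)), Limits.zero_comp]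
  · simp

/-- The identity matrix. -/
noncomputable def one (x : OneMor a b) : TwoMor x x :=
  mono (Equiv.refl _) (fun _ => 𝟙 _) (fun i => (sub_self (x.shift i)).symm ▸ Star.id_mem (x.word i))

theorem one_entry_self (x : OneMor a b) (i : x.ι) : (one x).entry i i = 𝟙 _ :=
  mono_entry_self (y := x) (Equiv.refl _) _ _ i

theorem one_entry_ne (x : OneMor a b) {i j : x.ι} (h : i ≠ j) : (one x).entry i j = 0 :=
  mono_entry_ne (y := x) (Equiv.refl _) _ _ h

end TwoMor

section Setup

/-- Vertical composition is matrix multiplication. -/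
@[reducible] noncomputable def homCat (a b : T.Env) : Category (OneMor a b) where
  Hom x y := TwoMor x y
  id x := TwoMor.one x
  comp s r := s.comp r
  id_comp s := by
    ext i j
    exact (TwoMor.mono_comp_entry _ _ _ s i j).trans (Category.id_comp _)
  comp_id {x y} s := by
    ext i j
    exact (TwoMor.comp_mono_entry s (Equiv.refl _) _ _ i j).trans (Category.comp_id _)
  assoc s r q := by
    ext i j
    simp only [TwoMor.comp_entry, Preadditive.sum_comp, Preadditive.comp_sum, Category.assoc]
    exact Finset.sum_comm

attribute [local instance] homCat

namespace OneMor

/-- The identity 1-morphism. -/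
abbrev one (a : T.Env) : OneMor a a := ⟨Unit, fun _ => 𝟙 a.base, fun _ => 0⟩

/-- Composition of 1-morphisms (first `x`, then `y`), distributing over direct sums. -/
abbrev comp {a b c : T.Env} (x : OneMor a b) (y : OneMor b c) : OneMor a c :=
  ⟨x.ι × y.ι, fun p => x.word p.1 ≫ y.word p.2, fun p => x.shift p.1 + y.shift p.2⟩

/-- The grading shift `x⟨n⟩`. -/
abbrev shiftBy {a b : T.Env} (x : OneMor a b) (n : ℤ) : OneMor a b :=
  ⟨x.ι, x.word, fun i => x.shift i + n⟩

/-- A single word in degree zero. -/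
abbrev single {a b : T.Env} (f : a.base ⟶ b.base) : OneMor a b := ⟨Unit, fun _ => f, fun _ => 0⟩

end OneMor

namespace TwoMor

variable {a b c d e : T.Env}

open scoped Classical in
/-- Horizontal composition with the identity of `x` performed first. -/
noncomputable def wL (x : OneMor a b) {y z : OneMor b c} (s : TwoMor y z) :
    TwoMor (x.comp y) (x.comp z) where
  entry p q := if h : p.1 = q.1 then
      (x.word p.1 ◁ s.entry p.2 q.2) ≫ eqToHom (congrArg (fun i => x.word i ≫ z.word q.2) h)
    else 0
  mem p q := by
    split_ifs with h
    · obtain ⟨i, j⟩ := p; obtain ⟨i', l⟩ := q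
      obtain rfl : i = i' := h
      exact (show z.shift l - y.shift j + 0 = x.shift i + z.shift l - (x.shift i + y.shift j) by
        omega) ▸ Star.comp_mem (Star.whiskerLeft_mem (x.word i) (s.mem j l)) (Star.eqToHom_mem rfl)
    · exact zero_mem _

open scoped Classical in
/-- Horizontal composition with the identity of `z` performed last. -/
noncomputable def wR {x y : OneMor a b} (s : TwoMor x y) (z : OneMor b c) :
    TwoMor (x.comp z) (y.comp z) where
  entry p q := if h : p.2 = q.2 then
      (s.entry p.1 q.1 ▷ z.word p.2) ≫ eqToHom (congrArg (fun i => y.word q.1 ≫ z.word i) h)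
    else 0
  mem p q := by
    split_ifs with h
    · obtain ⟨i, j⟩ := p; obtain ⟨l, j'⟩ := q
      obtain rfl : j = j' := h
      exact (show y.shift l - x.shift i + 0 = y.shift l + z.shift j - (x.shift i + z.shift j) by
        omega) ▸ Star.comp_mem (Star.whiskerRight_mem (z.word j) (s.mem i l)) (Star.eqToHom_mem rfl)
    · exact zero_mem _

theorem wL_entry_self (x : OneMor a b) {y z : OneMor b c} (s : TwoMor y z) (i : x.ι) (j : y.ι)
    (l : z.ι) : (wL x s).entry (i, j) (i, l) = x.word i ◁ s.entry j l :=
  (dif_pos rfl).trans (Category.comp_id _)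

theorem wL_entry_ne (x : OneMor a b) {y z : OneMor b c} (s : TwoMor y z) {i i' : x.ι} (h : i ≠ i')
    (j : y.ι) (l : z.ι) : (wL x s).entry (i, j) (i', l) = 0 := by
  simp [wL, h]

theorem wR_entry_self {x y : OneMor a b} (s : TwoMor x y) (z : OneMor b c) (i : x.ι) (j : y.ι)
    (l : z.ι) : (wR s z).entry (i, l) (j, l) = s.entry i j ▷ z.word l :=
  (dif_pos rfl).trans (Category.comp_id _)

theorem wR_entry_ne {x y : OneMor a b} (s : TwoMor x y) (z : OneMor b c) (i : x.ι) (j : y.ι)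
    {l l' : z.ι} (h : l ≠ l') : (wR s z).entry (i, l) (j, l') = 0 := by
  simp [wR, h]

end TwoMor


/-- A bijection of the summands of `x` and `y` with isomorphisms of degree zero between
corresponding summands. -/
structure Reindex {a b : T.Env} (x y : OneMor a b) where
  /-- the bijection -/
  σ : x.ι ≃ y.ι
  /-- the isomorphisms -/
  θ : ∀ i, x.word i ≅ y.word (σ i)
  hom_mem : ∀ i, (θ i).hom ∈ Star.homog _ _ (y.shift (σ i) - x.shift i)
  inv_mem : ∀ i, (θ i).inv ∈ Star.homog _ _ (x.shift i - y.shift (σ i))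

namespace Reindex

variable {a b : T.Env} {x y z : OneMor a b} (R : Reindex x y)

/-- The isomorphism of direct sums given by `R`. -/
noncomputable def iso : x ≅ y where
  hom := TwoMor.mono R.σ (fun i => (R.θ i).hom) R.hom_mem
  inv := TwoMor.comono R.σ (fun i => (R.θ i).inv) R.inv_mem
  hom_inv_id := by
    refine TwoMor.ext (funext fun i => funext fun j => ?_)
    refine (TwoMor.mono_comp_entry _ _ _ _ i j).trans ?_
    by_cases h : i = j
    · subst h
      rw [TwoMor.comono_entry_self, Iso.hom_inv_id]
      exact (TwoMor.one_entry_self x i).symm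
    · rw [TwoMor.comono_entry_ne _ _ _ (fun e => h (R.σ.injective e).symm), Limits.comp_zero]
      exact (TwoMor.one_entry_ne x h).symm
  inv_hom_id := by
    refine TwoMor.ext (funext fun i => funext fun j => ?_)
    obtain ⟨i, rfl⟩ := R.σ.surjective i
    refine (TwoMor.comono_comp_entry _ _ _ _ i j).trans ?_
    by_cases h : R.σ i = j
    · subst h
      rw [TwoMor.mono_entry_self, Iso.inv_hom_id]
      exact (TwoMor.one_entry_self y _).symm
    · rw [TwoMor.mono_entry_ne _ _ _ h, Limits.comp_zero]
      exact (TwoMor.one_entry_ne y h).symm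

theorem hom_comp (r : y ⟶ z) (i : x.ι) (l : z.ι) :
    TwoMor.entry (R.iso.hom ≫ r) i l = (R.θ i).hom ≫ TwoMor.entry r (R.σ i) l :=
  TwoMor.mono_comp_entry R.σ (fun i => (R.θ i).hom) R.hom_mem r i l

theorem comp_hom (r : z ⟶ x) (l : z.ι) (i : x.ι) :
    TwoMor.entry (r ≫ R.iso.hom) l (R.σ i) = TwoMor.entry r l i ≫ (R.θ i).hom :=
  TwoMor.comp_mono_entry r R.σ (fun i => (R.θ i).hom) R.hom_mem l i

theorem comp_inv (r : z ⟶ y) (l : z.ι) (i : x.ι) :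
    TwoMor.entry (r ≫ R.iso.inv) l i = TwoMor.entry r l (R.σ i) ≫ (R.θ i).inv :=
  TwoMor.comp_comono_entry r R.σ (fun i => (R.θ i).inv) R.inv_mem l i

theorem inv_comp (r : x ⟶ z) (i : x.ι) (l : z.ι) :
    TwoMor.entry (R.iso.inv ≫ r) (R.σ i) l = (R.θ i).inv ≫ TwoMor.entry r i l :=
  TwoMor.comono_comp_entry R.σ (fun i => (R.θ i).inv) R.inv_mem r i l

theorem conj_entry {x' y' : OneMor a b} (R' : Reindex x' y') (r : y ⟶ y') (i : x.ι) (j : x'.ι) :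
    TwoMor.entry (R.iso.hom ≫ r ≫ R'.iso.inv) i j =
      (R.θ i).hom ≫ TwoMor.entry r (R.σ i) (R'.σ j) ≫ (R'.θ j).inv := by
  rw [hom_comp, comp_inv]

theorem hom_self (i : x.ι) : TwoMor.entry R.iso.hom i (R.σ i) = (R.θ i).hom :=
  TwoMor.mono_entry_self R.σ (fun i => (R.θ i).hom) R.hom_mem i

theorem hom_ne {i : x.ι} {j : y.ι} (h : R.σ i ≠ j) : TwoMor.entry R.iso.hom i j = 0 :=
  TwoMor.mono_entry_ne R.σ (fun i => (R.θ i).hom) R.hom_mem h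

end Reindex

/-- Composition of direct sums of shifted words. -/
@[reducible] def oneCat (T : Presentation.{u, v, w, t} k 𝒞) : CategoryStruct T.Env where
  Hom a b := OneMor a b
  id a := OneMor.one a
  comp x y := x.comp y

/-- Associativity of composition, up to reindexing the summands. -/
noncomputable abbrev assocRe {a b c d : T.Env} (x : OneMor a b) (y : OneMor b c) (z : OneMor c d) :
    Reindex ((x.comp y).comp z) (x.comp (y.comp z)) where
  σ := Equiv.prodAssoc x.ι y.ι z.ι
  θ p := α_ (x.word p.1.1) (y.word p.1.2) (z.word p.2)
  hom_mem p := (show (0 : ℤ) = x.shift p.1.1 + (y.shift p.1.2 + z.shift p.2) -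
    (x.shift p.1.1 + y.shift p.1.2 + z.shift p.2) by omega) ▸ Star.eqToHom_mem (Star.hom_assoc _ _ _)
  inv_mem p := (show (0 : ℤ) = x.shift p.1.1 + y.shift p.1.2 + z.shift p.2 -
    (x.shift p.1.1 + (y.shift p.1.2 + z.shift p.2)) by omega) ▸
      Star.eqToHom_mem (Star.hom_assoc _ _ _).symm

/-- Left unit law, up to reindexing the summands. -/
noncomputable abbrev leftRe {a b : T.Env} (x : OneMor a b) : Reindex ((OneMor.one a).comp x) x where
  σ := Equiv.punitProd x.ι
  θ p := λ_ (x.word p.2)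
  hom_mem p := (show (0 : ℤ) = x.shift p.2 - (0 + x.shift p.2) by omega) ▸
    Star.eqToHom_mem (Star.hom_id_comp _)
  inv_mem p := (show (0 : ℤ) = 0 + x.shift p.2 - x.shift p.2 by omega) ▸
    Star.eqToHom_mem (Star.hom_id_comp _).symm

/-- Right unit law, up to reindexing the summands. -/
noncomputable abbrev rightRe {a b : T.Env} (x : OneMor a b) : Reindex (x.comp (OneMor.one b)) x where
  σ := Equiv.prodPUnit x.ι
  θ p := ρ_ (x.word p.1)
  hom_mem p := (show (0 : ℤ) = x.shift p.1 - (x.shift p.1 + 0) by omega) ▸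
    Star.eqToHom_mem (Star.hom_comp_id _)
  inv_mem p := (show (0 : ℤ) = x.shift p.1 + 0 - x.shift p.1 by omega) ▸
    Star.eqToHom_mem (Star.hom_comp_id _).symm

section Axioms

variable {a b c d e : T.Env}

theorem wL_one (x : OneMor a b) (y : OneMor b c) :
    TwoMor.wL x (TwoMor.one y) = TwoMor.one (x.comp y) := by
  refine TwoMor.ext (funext fun p => funext fun q => ?_)
  obtain ⟨i, j⟩ := p; obtain ⟨i', j'⟩ := q
  by_cases hi : i = i'
  · subst hi
    rw [TwoMor.wL_entry_self]
    by_cases hj : j = j'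
    · subst hj
      rw [TwoMor.one_entry_self, whiskerLeft_id]; exact (TwoMor.one_entry_self (x.comp y) (i, j)).symm
    · rw [TwoMor.one_entry_ne _ hj, Star.whiskerLeft_zero]
      exact (TwoMor.one_entry_ne (x.comp y) (fun h => hj (Prod.mk.inj h).2)).symm
  · rw [TwoMor.wL_entry_ne _ _ hi]
    exact (TwoMor.one_entry_ne (x.comp y) (fun h => hi (Prod.mk.inj h).1)).symm

theorem one_wR (x : OneMor a b) (y : OneMor b c) :
    TwoMor.wR (TwoMor.one x) y = TwoMor.one (x.comp y) := by
  refine TwoMor.ext (funext fun p => funext fun q => ?_)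
  obtain ⟨i, j⟩ := p; obtain ⟨i', j'⟩ := q
  by_cases hj : j = j'
  · subst hj
    rw [TwoMor.wR_entry_self]
    by_cases hi : i = i'
    · subst hi
      rw [TwoMor.one_entry_self, id_whiskerRight]; exact (TwoMor.one_entry_self (x.comp y) (i, j)).symm
    · rw [TwoMor.one_entry_ne _ hi, Star.zero_whiskerRight]
      exact (TwoMor.one_entry_ne (x.comp y) (fun h => hi (Prod.mk.inj h).1)).symm
  · rw [TwoMor.wR_entry_ne _ _ _ _ hj]
    exact (TwoMor.one_entry_ne (x.comp y) (fun h => hj (Prod.mk.inj h).2)).symm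

theorem wL_comp (x : OneMor a b) {y z v : OneMor b c} (s : TwoMor y z) (r : TwoMor z v) :
    TwoMor.wL x (s.comp r) = (TwoMor.wL x s).comp (TwoMor.wL x r) := by
  refine TwoMor.ext (funext fun p => funext fun q => ?_)
  obtain ⟨i, j⟩ := p; obtain ⟨i', j'⟩ := q
  refine Eq.trans ?_ (Fintype.sum_prod_type _).symm
  by_cases hi : i = i'
  · subst hi
    rw [TwoMor.wL_entry_self, Finset.sum_eq_single i, TwoMor.comp_entry, Star.whiskerLeft_sum]
    · refine Finset.sum_congr rfl fun l _ => ?_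
      rw [TwoMor.wL_entry_self, TwoMor.wL_entry_self, whiskerLeft_comp]
    · intro l _ hl
      refine Finset.sum_eq_zero fun m _ => ?_
      rw [TwoMor.wL_entry_ne _ _ hl.symm, Limits.zero_comp]
    · exact fun h => absurd (Finset.mem_univ _) h
  · rw [TwoMor.wL_entry_ne _ _ hi]
    refine (Finset.sum_eq_zero fun l _ => Finset.sum_eq_zero fun m _ => ?_).symm
    by_cases hl : i = l
    · subst hl; rw [TwoMor.wL_entry_ne _ r hi, Limits.comp_zero]
    · rw [TwoMor.wL_entry_ne _ _ hl, Limits.zero_comp]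

theorem comp_wR {x y z : OneMor a b} (s : TwoMor x y) (r : TwoMor y z) (v : OneMor b c) :
    TwoMor.wR (s.comp r) v = (TwoMor.wR s v).comp (TwoMor.wR r v) := by
  refine TwoMor.ext (funext fun p => funext fun q => ?_)
  obtain ⟨i, j⟩ := p; obtain ⟨i', j'⟩ := q
  refine Eq.trans ?_ (Fintype.sum_prod_type_right _).symm
  by_cases hj : j = j'
  · subst hj
    rw [TwoMor.wR_entry_self, Finset.sum_eq_single j, TwoMor.comp_entry, Star.sum_whiskerRight]
    · refine Finset.sum_congr rfl fun l _ => ?_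
      rw [TwoMor.wR_entry_self, TwoMor.wR_entry_self, comp_whiskerRight]
    · intro l _ hl
      refine Finset.sum_eq_zero fun m _ => ?_
      rw [TwoMor.wR_entry_ne _ _ _ _ hl.symm, Limits.zero_comp]
    · simp
  · rw [TwoMor.wR_entry_ne _ _ _ _ hj]
    refine (Finset.sum_eq_zero fun l _ => Finset.sum_eq_zero fun m _ => ?_).symm
    by_cases hl : j = l
    · subst hl; rw [TwoMor.wR_entry_ne r _ _ _ hj, Limits.comp_zero]
    · rw [TwoMor.wR_entry_ne _ _ _ _ hl, Limits.zero_comp]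

theorem one_wL {x y : OneMor a b} (s : TwoMor x y) :
    TwoMor.wL (OneMor.one a) s = (leftRe x).iso.hom ≫ s ≫ (leftRe y).iso.inv := by
  refine TwoMor.ext (funext fun p => funext fun q => ?_)
  obtain ⟨⟨⟩, j⟩ := p; obtain ⟨⟨⟩, j'⟩ := q
  refine (TwoMor.wL_entry_self _ _ _ _ _).trans ?_
  exact (id_whiskerLeft _).trans ((leftRe x).conj_entry (leftRe y) s (Unit.unit, j) (Unit.unit, j')).symm

theorem wR_one {x y : OneMor a b} (s : TwoMor x y) :
    TwoMor.wR s (OneMor.one b) = (rightRe x).iso.hom ≫ s ≫ (rightRe y).iso.inv := by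
  refine TwoMor.ext (funext fun p => funext fun q => ?_)
  obtain ⟨j, ⟨⟩⟩ := p; obtain ⟨j', ⟨⟩⟩ := q
  refine (TwoMor.wR_entry_self _ _ _ _ _).trans ?_
  exact (whiskerRight_id _).trans ((rightRe x).conj_entry (rightRe y) s (j, Unit.unit) (j', Unit.unit)).symm

theorem comp_wL (x : OneMor a b) (y : OneMor b c) {z z' : OneMor c d} (s : TwoMor z z') :
    TwoMor.wL (x.comp y) s =
      (assocRe x y z).iso.hom ≫ TwoMor.wL x (TwoMor.wL y s) ≫ (assocRe x y z').iso.inv := by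
  refine TwoMor.ext (funext fun p => funext fun q => ?_)
  obtain ⟨⟨i, j⟩, l⟩ := p; obtain ⟨⟨i', j'⟩, l'⟩ := q
  refine Eq.trans ?_ ((assocRe x y z).conj_entry (assocRe x y z') _ _ _).symm
  change _ = (α_ (x.word i) (y.word j) (z.word l)).hom ≫
    TwoMor.entry (TwoMor.wL x (TwoMor.wL y s)) (i, (j, l)) (i', (j', l')) ≫
      (α_ (x.word i') (y.word j') (z'.word l')).inv
  by_cases hi : i = i'
  · subst hi
    by_cases hj : j = j'
    · subst hj
      refine (TwoMor.wL_entry_self (x.comp y) s (i, j) l l').trans ?_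
      rw [TwoMor.wL_entry_self x (TwoMor.wL y s) i (j, l) (j, l'), TwoMor.wL_entry_self y]
      exact comp_whiskerLeft _ _ _
    · refine (TwoMor.wL_entry_ne (x.comp y) s (fun h => hj (Prod.mk.inj h).2) l l').trans ?_
      rw [TwoMor.wL_entry_self x (TwoMor.wL y s) i (j, l) (j', l'), TwoMor.wL_entry_ne y _ hj,
        Star.whiskerLeft_zero, Limits.zero_comp, Limits.comp_zero]
  · refine (TwoMor.wL_entry_ne (x.comp y) s (fun h => hi (Prod.mk.inj h).1) l l').trans ?_
    rw [TwoMor.wL_entry_ne x (TwoMor.wL y s) hi (j, l) (j', l'), Limits.zero_comp, Limits.comp_zero]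

theorem wL_wR (x : OneMor a b) {y y' : OneMor b c} (s : TwoMor y y') (z : OneMor c d) :
    TwoMor.wR (TwoMor.wL x s) z =
      (assocRe x y z).iso.hom ≫ TwoMor.wL x (TwoMor.wR s z) ≫ (assocRe x y' z).iso.inv := by
  refine TwoMor.ext (funext fun p => funext fun q => ?_)
  obtain ⟨⟨i, j⟩, l⟩ := p; obtain ⟨⟨i', j'⟩, l'⟩ := q
  refine Eq.trans ?_ ((assocRe x y z).conj_entry (assocRe x y' z) _ _ _).symm
  change _ = (α_ (x.word i) (y.word j) (z.word l)).hom ≫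
    TwoMor.entry (TwoMor.wL x (TwoMor.wR s z)) (i, (j, l)) (i', (j', l')) ≫
      (α_ (x.word i') (y'.word j') (z.word l')).inv
  by_cases hl : l = l'
  · subst hl
    refine (TwoMor.wR_entry_self (TwoMor.wL x s) z (i, j) (i', j') l).trans ?_
    by_cases hi : i = i'
    · subst hi
      rw [TwoMor.wL_entry_self x (TwoMor.wR s z) i (j, l) (j', l), TwoMor.wR_entry_self s, TwoMor.wL_entry_self x]
      exact whisker_assoc _ _ _
    · rw [TwoMor.wL_entry_ne x (TwoMor.wR s z) hi (j, l) (j', l), TwoMor.wL_entry_ne x _ hi,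
        Star.zero_whiskerRight, Limits.zero_comp, Limits.comp_zero]
  · refine (TwoMor.wR_entry_ne (TwoMor.wL x s) z (i, j) (i', j') hl).trans ?_
    by_cases hi : i = i'
    · subst hi
      rw [TwoMor.wL_entry_self x (TwoMor.wR s z) i (j, l) (j', l'), TwoMor.wR_entry_ne s _ _ _ hl,
        Star.whiskerLeft_zero, Limits.zero_comp, Limits.comp_zero]
    · rw [TwoMor.wL_entry_ne x (TwoMor.wR s z) hi (j, l) (j', l'), Limits.zero_comp, Limits.comp_zero]

theorem wR_comp {x x' : OneMor a b} (s : TwoMor x x') (y : OneMor b c) (z : OneMor c d) :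
    TwoMor.wR s (y.comp z) =
      (assocRe x y z).iso.inv ≫ TwoMor.wR (TwoMor.wR s y) z ≫ (assocRe x' y z).iso.hom := by
  refine (Iso.eq_inv_comp (assocRe x y z).iso).2 ((Iso.comp_inv_eq (assocRe x' y z).iso).1
    ((Category.assoc (assocRe x y z).iso.hom _ _).trans ?_))
  refine TwoMor.ext (funext fun p => funext fun q => ?_)
  obtain ⟨⟨i, j⟩, l⟩ := p; obtain ⟨⟨i', j'⟩, l'⟩ := q
  refine ((assocRe x y z).conj_entry (assocRe x' y z) _ _ _).trans ?_
  change (α_ (x.word i) (y.word j) (z.word l)).hom ≫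
    TwoMor.entry (TwoMor.wR s (y.comp z)) (i, (j, l)) (i', (j', l')) ≫
      (α_ (x'.word i') (y.word j') (z.word l')).inv = _
  by_cases hl : l = l'
  · subst hl
    refine Eq.trans ?_ (TwoMor.wR_entry_self (TwoMor.wR s y) z (i, j) (i', j') l).symm
    by_cases hj : j = j'
    · subst hj
      rw [TwoMor.wR_entry_self s (y.comp z) i i' (j, l), TwoMor.wR_entry_self s]
      refine (congrArg (fun q => _ ≫ q ≫ _) (whiskerRight_comp _ _ _)).trans ?_
      simp
    · rw [TwoMor.wR_entry_ne s (y.comp z) i i' (fun h => hj (Prod.mk.inj h).1),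
        TwoMor.wR_entry_ne s _ _ _ hj, Star.zero_whiskerRight, Limits.zero_comp, Limits.comp_zero]
  · refine Eq.trans ?_ (TwoMor.wR_entry_ne (TwoMor.wR s y) z (i, j) (i', j') hl).symm
    rw [TwoMor.wR_entry_ne s (y.comp z) i i' (fun h => hl (Prod.mk.inj h).2), Limits.zero_comp,
      Limits.comp_zero]

theorem exchange {x x' : OneMor a b} {y y' : OneMor b c} (s : TwoMor x x') (r : TwoMor y y') :
    (TwoMor.wL x r).comp (TwoMor.wR s y') = (TwoMor.wR s y).comp (TwoMor.wL x' r) := by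
  refine TwoMor.ext (funext fun p => funext fun q => ?_)
  obtain ⟨i, j⟩ := p; obtain ⟨i', j'⟩ := q
  have h₁ : ((TwoMor.wL x r).comp (TwoMor.wR s y')).entry (i, j) (i', j') =
      (x.word i ◁ r.entry j j') ≫ (s.entry i i' ▷ y'.word j') := by
    rw [TwoMor.comp_entry, Finset.sum_eq_single (i, j'), TwoMor.wL_entry_self,
      TwoMor.wR_entry_self]
    · rintro ⟨l, m⟩ _ hlm
      by_cases hl : i = l
      · subst hl
        rw [TwoMor.wR_entry_ne s y' i i' (fun h => hlm (by rw [h])), Limits.comp_zero]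
      · rw [TwoMor.wL_entry_ne x r hl, Limits.zero_comp]
    · exact fun h => absurd (Finset.mem_univ _) h
  have h₂ : ((TwoMor.wR s y).comp (TwoMor.wL x' r)).entry (i, j) (i', j') =
      (s.entry i i' ▷ y.word j) ≫ (x'.word i' ◁ r.entry j j') := by
    rw [TwoMor.comp_entry, Finset.sum_eq_single (i', j), TwoMor.wL_entry_self,
      TwoMor.wR_entry_self]
    · rintro ⟨l, m⟩ _ hlm
      by_cases hl : j = m
      · subst hl
        rw [TwoMor.wL_entry_ne x' r (fun h => hlm (by rw [h])), Limits.comp_zero]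
      · rw [TwoMor.wR_entry_ne s y i l hl, Limits.zero_comp]
    · exact fun h => absurd (Finset.mem_univ _) h
  rw [h₁, h₂]
  exact whisker_exchange _ _

theorem comp_entry_of {x y z : OneMor a b} (s : TwoMor x y) (r : TwoMor y z) (i : x.ι) (j : y.ι)
    (l : z.ι) (h : ∀ j', j ≠ j' → s.entry i j' = 0) :
    (s.comp r).entry i l = s.entry i j ≫ r.entry j l := by
  rw [TwoMor.comp_entry, Finset.sum_eq_single j]
  · intro j' _ hj
    rw [h j' hj.symm, Limits.zero_comp]
  · exact fun h => absurd (Finset.mem_univ _) h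

theorem pentagon (x : OneMor a b) (y : OneMor b c) (z : OneMor c d) (v : OneMor d e) :
    (TwoMor.wR (assocRe x y z).iso.hom v).comp ((assocRe x (y.comp z) v).iso.hom ≫
      TwoMor.wL x (assocRe y z v).iso.hom) =
      (assocRe (x.comp y) z v).iso.hom ≫ (assocRe x y (z.comp v)).iso.hom := by
  refine TwoMor.ext (funext fun p => funext fun q => ?_)
  obtain ⟨⟨⟨i, j⟩, l⟩, m⟩ := p; obtain ⟨i', ⟨j', ⟨l', m'⟩⟩⟩ := q
  refine (comp_entry_of _ _ _ ((i, (j, l)), m) _ ?_).trans ?_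
  · rintro ⟨q, m'⟩ h
    by_cases hm : m = m'
    · subst hm
      rw [TwoMor.wR_entry_self, (assocRe x y z).hom_ne (fun e => h (Prod.ext e rfl)),
        Star.zero_whiskerRight]
    · rw [TwoMor.wR_entry_ne _ _ _ _ hm]
  refine (congrArg₂ (· ≫ ·) ((TwoMor.wR_entry_self (assocRe x y z).iso.hom v ((i, j), l)
      (i, (j, l)) m).trans (congrArg (· ▷ v.word m) ((assocRe x y z).hom_self ((i, j), l))))
    ((assocRe x (y.comp z) v).hom_comp _ ((i, (j, l)), m) _)).trans ?_
  refine Eq.trans ?_ ((assocRe (x.comp y) z v).hom_comp _ (((i, j), l), m) _).symm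
  change ((α_ (x.word i) (y.word j) (z.word l)).hom ▷ v.word m) ≫
    (α_ (x.word i) (y.word j ≫ z.word l) (v.word m)).hom ≫
      (TwoMor.wL x (assocRe y z v).iso.hom).entry (i, ((j, l), m)) (i', (j', (l', m'))) =
    (α_ (x.word i ≫ y.word j) (z.word l) (v.word m)).hom ≫
      TwoMor.entry (assocRe x y (z.comp v)).iso.hom ((i, j), (l, m)) (i', (j', (l', m')))
  by_cases hi : i = i'
  · subst hi
    rw [TwoMor.wL_entry_self (y := (y.comp z).comp v) (z := y.comp (z.comp v)) x _ i ((j, l), m)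
      (j', (l', m'))]
    by_cases h : (j, (l, m)) = (j', (l', m'))
    · cases h
      have h₁ : TwoMor.entry (assocRe y z v).iso.hom ((j, l), m) (j, (l, m)) =
        (α_ (y.word j) (z.word l) (v.word m)).hom := (assocRe y z v).hom_self ((j, l), m)
      have h₂ : TwoMor.entry (assocRe x y (z.comp v)).iso.hom ((i, j), (l, m)) (i, (j, (l, m))) =
        (α_ (x.word i) (y.word j) (z.word l ≫ v.word m)).hom :=
        (assocRe x y (z.comp v)).hom_self ((i, j), (l, m))
      rw [h₁, h₂]
      exact Bicategory.pentagon _ _ _ _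
    · rw [(assocRe y z v).hom_ne h,
        (assocRe x y (z.comp v)).hom_ne (fun e => h (Prod.mk.inj e).2), Star.whiskerLeft_zero,
        Limits.comp_zero, Limits.comp_zero, Limits.comp_zero]
  · rw [TwoMor.wL_entry_ne x _ hi,
      (assocRe x y (z.comp v)).hom_ne (fun e => hi (Prod.mk.inj e).1), Limits.comp_zero,
      Limits.comp_zero, Limits.comp_zero]

theorem triangle (x : OneMor a b) (y : OneMor b c) :
    (assocRe x (OneMor.one b) y).iso.hom ≫ TwoMor.wL x (leftRe y).iso.hom =
      TwoMor.wR (rightRe x).iso.hom y := by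
  refine TwoMor.ext (funext fun p => funext fun q => ?_)
  obtain ⟨⟨i, ⟨⟩⟩, j⟩ := p; obtain ⟨i', j'⟩ := q
  have hL (j : y.ι) : TwoMor.entry (leftRe y).iso.hom (Unit.unit, j) j = (λ_ (y.word j)).hom :=
    (leftRe y).hom_self (Unit.unit, j)
  have hL' {j j' : y.ι} (h : j ≠ j') : TwoMor.entry (leftRe y).iso.hom (Unit.unit, j) j' = 0 :=
    (leftRe y).hom_ne h
  have hR (i : x.ι) : TwoMor.entry (rightRe x).iso.hom (i, Unit.unit) i = (ρ_ (x.word i)).hom :=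
    (rightRe x).hom_self (i, Unit.unit)
  have hR' {i i' : x.ι} (h : i ≠ i') : TwoMor.entry (rightRe x).iso.hom (i, Unit.unit) i' = 0 :=
    (rightRe x).hom_ne h
  have hW := TwoMor.wR_entry_self (x := x.comp (OneMor.one b)) (y := x) (rightRe x).iso.hom y
  have hW' := @TwoMor.wR_entry_ne _ _ _ _ T _ _ _ (x.comp (OneMor.one b)) x
    (rightRe x).iso.hom y
  refine ((assocRe x (OneMor.one b) y).hom_comp (z := x.comp y) _ ((i, Unit.unit), j)
    (i', j')).trans ?_
  change (α_ (x.word i) (𝟙 b.base) (y.word j)).hom ≫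
    (TwoMor.wL x (leftRe y).iso.hom).entry (i, (Unit.unit, j)) (i', j') = _
  by_cases hi : i = i'
  · subst hi
    rw [TwoMor.wL_entry_self (y := (OneMor.one b).comp y) (z := y) x _ i (Unit.unit, j) j']
    by_cases hj : j = j'
    · subst hj
      refine Eq.trans ?_ (hW (i, Unit.unit) i j).symm
      rw [hL, hR]
      exact Bicategory.triangle _ _
    · refine Eq.trans ?_ (hW' (i, Unit.unit) i hj).symm
      rw [hL' hj, Star.whiskerLeft_zero, Limits.comp_zero]
  · rw [TwoMor.wL_entry_ne x _ hi, Limits.comp_zero]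
    by_cases hj : j = j'
    · subst hj
      refine Eq.trans ?_ (hW (i, Unit.unit) i' j).symm
      rw [hR' hi, Star.zero_whiskerRight]
    · exact (hW' (i, Unit.unit) i' hj).symm

end Axioms

attribute [local instance] oneCat

/-- The graded additive `k`-linear 2-category presented by `T`. -/
noncomputable instance instBicategory : Bicategory T.Env where
  toCategoryStruct := oneCat T
  homCategory := homCat
  whiskerLeft := TwoMor.wL
  whiskerRight := TwoMor.wR
  associator x y z := (assocRe x y z).iso
  leftUnitor x := (leftRe x).iso
  rightUnitor x := (rightRe x).iso
  whiskerLeft_id := wL_one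
  whiskerLeft_comp x _ _ _ s r := wL_comp x s r
  id_whiskerLeft := one_wL
  comp_whiskerLeft x y _ _ s := comp_wL x y s
  id_whiskerRight := one_wR
  comp_whiskerRight s r v := comp_wR s r v
  whiskerRight_id := wR_one
  whiskerRight_comp s y z := wR_comp s y z
  whisker_assoc x _ _ s z := wL_wR x s z
  whisker_exchange s r := exchange s r
  pentagon := pentagon
  triangle := triangle

end Setup

noncomputable instance (a b : T.Env) : Preadditive (a ⟶ b) where
  homGroup x y := inferInstanceAs (AddCommGroup (TwoMor x y))
  add_comp x y z s s' r := by
    refine TwoMor.ext (funext fun i => funext fun j => ?_)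
    exact (Finset.sum_congr rfl fun l _ => Preadditive.add_comp _ _ _ _ _ _).trans
      Finset.sum_add_distrib
  comp_add x y z s r r' := by
    refine TwoMor.ext (funext fun i => funext fun j => ?_)
    exact (Finset.sum_congr rfl fun l _ => Preadditive.comp_add _ _ _ _ _ _).trans
      Finset.sum_add_distrib

noncomputable instance (a b : T.Env) : Linear k (a ⟶ b) where
  homModule x y := inferInstanceAs (Module k (TwoMor x y))
  smul_comp x y z c s r := by
    refine TwoMor.ext (funext fun i => funext fun j => ?_)
    exact (Finset.sum_congr rfl fun l _ => Linear.smul_comp _ _ _ _ _ _).trans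
      Finset.smul_sum.symm
  comp_smul x y z s c r := by
    refine TwoMor.ext (funext fun i => funext fun j => ?_)
    exact (Finset.sum_congr rfl fun l _ => Linear.comp_smul _ _ _ _ _ _).trans
      Finset.smul_sum.symm


/-- The map on objects and 1-morphisms that is the identity on the data, between the 2-categories of
two presentations with the same underlying category. -/
def idOne (T T' : Presentation.{u, v, w, t} k 𝒞) : T.Env ⥤q T'.Env where
  obj a := ⟨⟨a.base.as⟩⟩
  map x := ⟨OneMor.ι x, OneMor.word x, OneMor.shift x⟩

/-- The grading shift `x⟨n⟩`. -/
abbrev shift {a b : T.Env} (x : a ⟶ b) (n : ℤ) : a ⟶ b := OneMor.shiftBy x n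

/-- A 1-morphism of `𝒞`, as a 1-morphism of the graded additive 2-category. -/
abbrev single (T : Presentation.{u, v, w, t} k 𝒞) {a b : 𝒞} (f : a ⟶ b) :
    (⟨⟨a⟩⟩ : T.Env) ⟶ ⟨⟨b⟩⟩ := OneMor.single (T := T) (a := ⟨⟨a⟩⟩) (b := ⟨⟨b⟩⟩) f

/-- The 2-morphism `x⟨n⟩ ⟶ y⟨n⟩` with the same entries as `s`. -/
def shiftHom {a b : T.Env} {x y : a ⟶ b} (s : x ⟶ y) (n : ℤ) : shift x n ⟶ shift y n where
  entry i j := TwoMor.entry (x := x) (y := y) s i j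
  mem i j := (add_sub_add_right_eq_sub (OneMor.shift y j) (OneMor.shift x i) n).symm ▸
    TwoMor.mem (x := x) (y := y) s i j

/-- The 2-morphism `f ⟶ g⟨d⟩` given by a formal expression of degree `d`. -/
def ofTerm {a b : 𝒞} {f g : a ⟶ b} (s : Term k T.gen f g) {d : ℤ} (h : s.HasDeg T.deg d) :
    single T f ⟶ shift (single T g) d where
  entry _ _ := Star.cls s
  mem _ _ := by
    refine ⟨s, ?_, rfl⟩
    simpa using h

end Presentation.Env

end Presentation

/-! ### Cartan data and parameters -/

/-- A simply-laced Cartan datum with index set `I` and weight lattice `X`. -/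
structure CartanDatum (I : Type u) (X : Type v) [AddCommGroup X] where
  /-- the simple roots -/
  α : I → X
  /-- the fundamental weights -/
  Λ : I → X
  /-- the simple coroots -/
  h : I → (X →ₗ[ℤ] ℤ)
  /-- the bilinear form on the weight lattice -/
  form : X →ₗ[ℤ] X →ₗ[ℤ] ℚ
  form_self : ∀ i, form (α i) (α i) = 2
  form_ne : ∀ i j, i ≠ j → form (α i) (α j) = 0 ∨ form (α i) (α j) = -1
  form_symm : ∀ i j, form (α i) (α j) = form (α j) (α i)
  h_eq_form : ∀ i x, (h i x : ℚ) = form (α i) x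
  h_Λ_self : ∀ i, h i (Λ i) = 1
  h_Λ_ne : ∀ i j, i ≠ j → h j (Λ i) = 0

section Concrete

variable {k : Type w} [CommRing k] {I : Type u} {X : Type v} [AddCommGroup X]

/-- A choice of scalars `Q`: units `t i j` for `i ≠ j`, symmetric when `a_ij = 0`. -/
structure Scalars (k : Type w) [CommRing k] (C : CartanDatum I X) where
  /-- the scalars -/
  t : ∀ i j : I, i ≠ j → kˣ
  symm : ∀ (i j : I) (hij : i ≠ j), C.h i (C.α j) = 0 → t i j hij = t j i hij.symm

/-- Bubble parameters. -/
structure BubbleParams (k : Type w) [CommRing k] (I : Type u) (X : Type v) where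
  /-- the parameters `β_{i,λ}` -/
  β : I → X → kˣ
  /-- the parameters `c⁺_{i,λ}` -/
  cp : I → X → kˣ
  /-- the parameters `c⁻_{i,λ}` -/
  cm : I → X → kˣ

/-- Compatibility of the bubble parameters with the scalars, where `t_ii = -β_{i,λ}`. -/
structure Compatible {C : CartanDatum I X} (Q : Scalars k C) (B : BubbleParams k I X) : Prop where
  mul_eq : ∀ i x, B.cp i x * B.cm i x = -(B.β i x)⁻¹
  cp_add : ∀ (i j : I) (hij : i ≠ j) (x : X), B.cp i (x + C.α j) = Q.t i j hij * B.cp i x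
  cm_sub : ∀ (i j : I) (hij : i ≠ j) (x : X), B.cm i (x - C.α j) = Q.t i j hij * B.cm i x
  cp_add_self : ∀ i x, B.cp i (x + C.α i) = -B.β i x * B.cp i x
  cm_sub_self : ∀ i x, B.cm i (x - C.α i) = -B.β i x * B.cm i x

/-- The rescaled scalars: `D_i t_ij` if `a_ij = -1`, and `t_ij` if `a_ij = 0`. -/
def Scalars.rescale {C : CartanDatum I X} (Q : Scalars k C) (D : I → kˣ) : Scalars k C where
  t i j hij := if C.h i (C.α j) = -1 then D i * Q.t i j hij else Q.t i j hij
  symm i j hij h0 := by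
    have h0' : C.h j (C.α i) = 0 := by
      have := C.form_symm i j
      rw [← C.h_eq_form, ← C.h_eq_form, h0] at this
      exact_mod_cast this.symm
    rw [h0, h0']
    simpa using Q.symm i j hij h0

/-- The rescaled bubble parameters. -/
def BubbleParams.rescale (C : CartanDatum I X) (B : BubbleParams k I X) (D : I → kˣ) :
    BubbleParams k I X where
  β i x := D i ^ (-2 : ℤ) * B.β i x
  cp i x := D i ^ (-C.h i x + 1) * B.cp i x
  cm i x := D i ^ (C.h i x + 1) * B.cm i x

/-! ### 1-morphisms -/

/-- The weights, as objects of a category. -/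
structure Wt (C : CartanDatum I X) where
  /-- the weight -/
  wt : X

/-- Words in the `E i` and `F i`: `Word a c` is the type of 1-morphisms from `a` to `c`.  The letter
`E i` raises the weight by `α i`, the letter `F i` lowers it by `α i`, and the last letter acts
last. -/
inductive Word (C : CartanDatum I X) : Wt C → Wt C → Type (max u v)
  | nil (a : Wt C) : Word C a a
  | E {a b c : Wt C} (p : Word C a b) (i : I) (h : b.wt + C.α i = c.wt) : Word C a c
  | F {a b c : Wt C} (p : Word C a b) (i : I) (h : c.wt + C.α i = b.wt) : Word C a c

/-- Concatenation of words. -/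
def Word.append {C : CartanDatum I X} {a b : Wt C} (p : Word C a b) :
    ∀ {c : Wt C}, Word C b c → Word C a c
  | _, .nil _ => p
  | _, .E q i h => (p.append q).E i h
  | _, .F q i h => (p.append q).F i h

instance (C : CartanDatum I X) : Category (Wt C) where
  Hom a b := Word C a b
  id a := .nil a
  comp p q := p.append q
  id_comp p := by
    induction p with
    | nil => rfl
    | E p i h ih => exact congrArg (fun q => Word.E q i h) ih
    | F p i h ih => exact congrArg (fun q => Word.F q i h) ih
  comp_id p := rfl
  assoc p q r := by
    induction r with
    | nil => rfl
    | E r i h ih => exact congrArg (fun q => Word.E q i h) ih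
    | F r i h ih => exact congrArg (fun q => Word.F q i h) ih

variable {C : CartanDatum I X}

/-- The 1-morphism `E i` from `λ` to `λ + α i`. -/
def oneE {a b : Wt C} (i : I) (h : a.wt + C.α i = b.wt) : a ⟶ b := (Word.nil a).E i h

/-- The 1-morphism `F i` from `λ + α i` to `λ`. -/
def oneF {a b : Wt C} (i : I) (h : a.wt + C.α i = b.wt) : b ⟶ a := (Word.nil b).F i h

/-! ### Generating 2-morphisms

Composites of 1-morphisms are written in the order in which they are performed, so `f ≫ g` is
drawn with `g` to the left of `f`. -/

/-- The generating 2-morphisms: upward dots and crossings, cups and caps. -/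
inductive Gen (C : CartanDatum I X) : ∀ ⦃a b : Wt C⦄, (a ⟶ b) → (a ⟶ b) → Type (max u v)
  /-- the dot on an upward strand -/
  | dot {a b : Wt C} (i : I) (h : a.wt + C.α i = b.wt) : Gen C (oneE i h) (oneE i h)
  /-- the upward crossing from `E_i E_j 1_λ` to `E_j E_i 1_λ` -/
  | cross {a b c d : Wt C} (i j : I) (hj : a.wt + C.α j = b.wt) (hi : b.wt + C.α i = d.wt)
      (hi' : a.wt + C.α i = c.wt) (hj' : c.wt + C.α j = d.wt) :
      Gen C (oneE j hj ≫ oneE i hi) (oneE i hi' ≫ oneE j hj')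
  /-- the cup from `1_λ` to `F_i E_i 1_λ` -/
  | cupFE {a b : Wt C} (i : I) (h : a.wt + C.α i = b.wt) : Gen C (𝟙 a) (oneE i h ≫ oneF i h)
  /-- the cup from `1_λ` to `E_i F_i 1_λ` -/
  | cupEF {a b : Wt C} (i : I) (h : a.wt + C.α i = b.wt) : Gen C (𝟙 b) (oneF i h ≫ oneE i h)
  /-- the cap from `F_i E_i 1_λ` to `1_λ` -/
  | capFE {a b : Wt C} (i : I) (h : a.wt + C.α i = b.wt) : Gen C (oneE i h ≫ oneF i h) (𝟙 a)
  /-- the cap from `E_i F_i 1_λ` to `1_λ` -/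
  | capEF {a b : Wt C} (i : I) (h : a.wt + C.α i = b.wt) : Gen C (oneF i h ≫ oneE i h) (𝟙 b)

/-- Degrees of the generating 2-morphisms. -/
def Gen.deg : ∀ ⦃a b : Wt C⦄ ⦃f g : a ⟶ b⦄, Gen C f g → ℤ
  | _, _, _, _, .dot _ _ => 2
  | _, _, _, _, .cross i j _ _ _ _ => -C.h i (C.α j)
  | _, _, _, _, @Gen.cupFE _ _ _ _ a _ i _ => 1 + C.h i a.wt
  | _, _, _, _, @Gen.cupEF _ _ _ _ _ b i _ => 1 - C.h i b.wt
  | _, _, _, _, @Gen.capFE _ _ _ _ a _ i _ => 1 + C.h i a.wt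
  | _, _, _, _, @Gen.capEF _ _ _ _ _ b i _ => 1 - C.h i b.wt

/-- Formal 2-morphisms. -/
abbrev Tm (k : Type w) {C : CartanDatum I X} {a b : Wt C} (f g : a ⟶ b) := Term k (Gen C) f g

namespace Tm

variable (k)

/-- The dot on an upward strand. -/
def dot {a b : Wt C} (i : I) (h : a.wt + C.α i = b.wt) : Tm k (oneE i h) (oneE i h) :=
  .gen (.dot i h)

/-- The crossing `E_i E_j ⟶ E_j E_i`. -/
def cross {a b c d : Wt C} (i j : I) (hj : a.wt + C.α j = b.wt) (hi : b.wt + C.α i = d.wt)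
    (hi' : a.wt + C.α i = c.wt) (hj' : c.wt + C.α j = d.wt) :
    Tm k (oneE j hj ≫ oneE i hi) (oneE i hi' ≫ oneE j hj') := .gen (.cross i j hj hi hi' hj')

/-- The cup `1 ⟶ F_i E_i`. -/
def cupFE {a b : Wt C} (i : I) (h : a.wt + C.α i = b.wt) : Tm k (𝟙 a) (oneE i h ≫ oneF i h) :=
  .gen (.cupFE i h)

/-- The cup `1 ⟶ E_i F_i`. -/
def cupEF {a b : Wt C} (i : I) (h : a.wt + C.α i = b.wt) : Tm k (𝟙 b) (oneF i h ≫ oneE i h) :=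
  .gen (.cupEF i h)

/-- The cap `F_i E_i ⟶ 1`. -/
def capFE {a b : Wt C} (i : I) (h : a.wt + C.α i = b.wt) : Tm k (oneE i h ≫ oneF i h) (𝟙 a) :=
  .gen (.capFE i h)

/-- The cap `E_i F_i ⟶ 1`. -/
def capEF {a b : Wt C} (i : I) (h : a.wt + C.α i = b.wt) : Tm k (oneF i h ≫ oneE i h) (𝟙 b) :=
  .gen (.capEF i h)

/-- A number of dots on an upward strand. -/
def dots {a b : Wt C} (i : I) (h : a.wt + C.α i = b.wt) : ℕ → Tm k (oneE i h) (oneE i h)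
  | 0 => .id _
  | n + 1 => (dots i h n).comp (dot k i h)

/-- The first rotation of the dot to a downward strand, by the cup `1 ⟶ F E` and the cap
`E F ⟶ 1`. -/
def dotRot₁ {a b : Wt C} (i : I) (h : a.wt + C.α i = b.wt) : Tm k (oneF i h) (oneF i h) :=
  (Term.id (oneF i h)).vert
    (((cupFE k i h).wl (oneF i h)).vert
      ((((dot k i h).wr (oneF i h)).wl (oneF i h)).vert
        (((capEF k i h).wr (oneF i h)).vert (Term.id (oneF i h)))))

/-- The second rotation of the dot to a downward strand, by the cup `1 ⟶ E F` and the cap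
`F E ⟶ 1`. -/
def dotRot₂ {a b : Wt C} (i : I) (h : a.wt + C.α i = b.wt) : Tm k (oneF i h) (oneF i h) :=
  (Term.id (oneF i h)).vert
    (((cupEF k i h).wr (oneF i h)).vert
      ((((dot k i h).wr (oneF i h)).wl (oneF i h)).vert
        (((capFE k i h).wl (oneF i h)).vert (Term.id (oneF i h)))))

/-- The first rotation of the upward crossing to the crossing `F_i F_j ⟶ F_j F_i`. -/
def crossRot₁ {a b c d : Wt C} (i j : I) (hj : a.wt + C.α j = b.wt) (hi : b.wt + C.α i = d.wt)
    (hi' : a.wt + C.α i = c.wt) (hj' : c.wt + C.α j = d.wt) :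
    Tm k (oneF j hj' ≫ oneF i hi') (oneF i hi ≫ oneF j hj) :=
  (Term.id (oneF j hj' ≫ oneF i hi')).vert
    (((cupFE k j hj).wl (oneF j hj' ≫ oneF i hi')).vert
      ((((cupFE k i hi).wr (oneF j hj)).wl (oneF j hj' ≫ oneF i hi' ≫ oneE j hj)).vert
        ((((cross k i j hj hi hi' hj').wr (oneF i hi ≫ oneF j hj)).wl
            (oneF j hj' ≫ oneF i hi')).vert
          ((((capEF k i hi').wr (oneE j hj' ≫ oneF i hi ≫ oneF j hj)).wl (oneF j hj')).vert
            (((capEF k j hj').wr (oneF i hi ≫ oneF j hj)).vert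
              (Term.id (oneF i hi ≫ oneF j hj)))))))

/-- The second rotation of the upward crossing to the crossing `F_i F_j ⟶ F_j F_i`. -/
def crossRot₂ {a b c d : Wt C} (i j : I) (hj : a.wt + C.α j = b.wt) (hi : b.wt + C.α i = d.wt)
    (hi' : a.wt + C.α i = c.wt) (hj' : c.wt + C.α j = d.wt) :
    Tm k (oneF j hj' ≫ oneF i hi') (oneF i hi ≫ oneF j hj) :=
  (Term.id (oneF j hj' ≫ oneF i hi')).vert
    (((cupEF k i hi).wr (oneF j hj' ≫ oneF i hi')).vert
      ((((cupEF k j hj).wr (oneE i hi ≫ oneF j hj' ≫ oneF i hi')).wl (oneF i hi)).vert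
        ((((cross k i j hj hi hi' hj').wr (oneF j hj' ≫ oneF i hi')).wl
            (oneF i hi ≫ oneF j hj)).vert
          ((((capFE k j hj').wr (oneF i hi')).wl (oneF i hi ≫ oneF j hj ≫ oneE i hi')).vert
            (((capFE k i hi').wl (oneF i hi ≫ oneF j hj)).vert
              (Term.id (oneF i hi ≫ oneF j hj)))))))

/-- The sideways crossing `E_i F_j ⟶ F_j E_i`. -/
def sideEF {a b c d : Wt C} (i j : I) (hi : a.wt + C.α i = b.wt) (hj : b.wt + C.α j = d.wt)
    (hj' : a.wt + C.α j = c.wt) (hi' : c.wt + C.α i = d.wt) :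
    Tm k (oneF j hj' ≫ oneE i hi) (oneE i hi' ≫ oneF j hj) :=
  (Term.id (oneF j hj' ≫ oneE i hi)).vert
    (((cupFE k j hj).wl (oneF j hj' ≫ oneE i hi)).vert
      ((((cross k j i hi hj hj' hi').wr (oneF j hj)).wl (oneF j hj')).vert
        (((capEF k j hj').wr (oneE i hi' ≫ oneF j hj)).vert
          (Term.id (oneE i hi' ≫ oneF j hj)))))

/-- The sideways crossing `F_i E_j ⟶ E_j F_i`. -/
def sideFE {a b c d : Wt C} (i j : I) (hi : a.wt + C.α i = b.wt) (hj : b.wt + C.α j = d.wt)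
    (hj' : a.wt + C.α j = c.wt) (hi' : c.wt + C.α i = d.wt) :
    Tm k (oneE j hj ≫ oneF i hi') (oneF i hi ≫ oneE j hj') :=
  (Term.id (oneE j hj ≫ oneF i hi')).vert
    (((cupEF k i hi).wr (oneE j hj ≫ oneF i hi')).vert
      ((((cross k j i hi hj hj' hi').wr (oneF i hi')).wl (oneF i hi)).vert
        (((capFE k i hi').wl (oneF i hi ≫ oneE j hj')).vert
          (Term.id (oneF i hi ≫ oneE j hj')))))

/-- The clockwise bubble with `m` dots in the region `λ = b`. -/
def realCw {a b : Wt C} (i : I) (h : a.wt + C.α i = b.wt) (m : ℕ) : Tm k (𝟙 b) (𝟙 b) :=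
  (cupEF k i h).comp (((dots k i h m).wl (oneF i h)).comp (capEF k i h))

/-- The counterclockwise bubble with `m` dots in the region `λ = a`. -/
def realCcw {a b : Wt C} (i : I) (h : a.wt + C.α i = b.wt) (m : ℕ) : Tm k (𝟙 a) (𝟙 a) :=
  (cupFE k i h).comp (((dots k i h m).wr (oneF i h)).comp (capFE k i h))

end Tm

/-- The weight `λ - α i`. -/
abbrev Wt.down (a : Wt C) (i : I) : Wt C := ⟨a.wt - C.α i⟩

/-- The weight `λ + α i`. -/
abbrev Wt.up (a : Wt C) (i : I) : Wt C := ⟨a.wt + C.α i⟩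

/-! ### Bubbles, including fake bubbles -/

namespace Tm

/-- The clockwise bubble with `m` dots in the region `a`. -/
def cwDots (k : Type w) (i : I) (a : Wt C) (m : ℕ) : Tm k (𝟙 a) (𝟙 a) :=
  realCw k (a := a.down i) (b := a) i (sub_add_cancel _ _) m

/-- The counterclockwise bubble with `m` dots in the region `a`. -/
def ccwDots (k : Type w) (i : I) (a : Wt C) (m : ℕ) : Tm k (𝟙 a) (𝟙 a) :=
  realCcw k (a := a) (b := a.up i) i rfl m

/-- The fake clockwise bubble of degree `2 n`, that is, with the label `λ_i - 1 + n`. -/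
def cwFake (B : BubbleParams k I X) (i : I) (a : Wt C) (n : ℕ) : Tm k (𝟙 a) (𝟙 a) :=
  match n with
  | 0 => (Term.id (𝟙 a)).smul (B.cp i a.wt : k)
  | n + 1 => (Term.listSum ((List.finRange (n + 1)).map fun y : Fin (n + 1) =>
      (cwFake B i a (n - y.val)).comp
        (ccwDots k i a (-C.h i a.wt - 1 + ((y.val : ℤ) + 1)).toNat))).smul
        (-(↑(B.cm i a.wt)⁻¹ : k))

/-- The fake counterclockwise bubble of degree `2 n`, that is, with the label `-λ_i - 1 + n`. -/
def ccwFake (B : BubbleParams k I X) (i : I) (a : Wt C) (n : ℕ) : Tm k (𝟙 a) (𝟙 a) :=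
  match n with
  | 0 => (Term.id (𝟙 a)).smul (B.cm i a.wt : k)
  | n + 1 => (Term.listSum ((List.finRange (n + 1)).map fun x : Fin (n + 1) =>
      (cwDots k i a (C.h i a.wt - 1 + ((x.val : ℤ) + 1)).toNat).comp
        (ccwFake B i a (n - x.val)))).smul
        (-(↑(B.cp i a.wt)⁻¹ : k))

/-- The clockwise bubble with any integer label `m`: the bubble with `m` dots if `m ≥ 0`, a fake
bubble of degree `2 (m + 1 - λ_i)` if `m < 0`. -/
def cw (B : BubbleParams k I X) (i : I) (a : Wt C) (m : ℤ) : Tm k (𝟙 a) (𝟙 a) :=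
  if 0 ≤ m then cwDots k i a m.toNat
  else if 0 ≤ m + 1 - C.h i a.wt then cwFake B i a (m + 1 - C.h i a.wt).toNat
  else .zero _ _

/-- The counterclockwise bubble with any integer label `m`: the bubble with `m` dots if `m ≥ 0`, a
fake bubble of degree `2 (m + 1 + λ_i)` if `m < 0`. -/
def ccw (B : BubbleParams k I X) (i : I) (a : Wt C) (m : ℤ) : Tm k (𝟙 a) (𝟙 a) :=
  if 0 ≤ m then ccwDots k i a m.toNat
  else if 0 ≤ m + 1 + C.h i a.wt then ccwFake B i a (m + 1 + C.h i a.wt).toNat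
  else .zero _ _

/-- The sum over `f₁ + f₂ + f₃ = λ_i - 1` in the `sl₂` relation for `E_i F_i 1_λ`: a cap with `f₁`
dots, then a counterclockwise bubble with the label `-λ_i - 1 + f₂`, then a cup with `f₃` dots. -/
def sumEF (B : BubbleParams k I X) {a b : Wt C} (i : I) (h : a.wt + C.α i = b.wt) :
    Tm k (oneF i h ≫ oneE i h) (oneF i h ≫ oneE i h) :=
  Term.listSum (if 0 ≤ C.h i b.wt - 1 then
    (List.Nat.antidiagonalTuple 3 (C.h i b.wt - 1).toNat).map fun f =>
      ((dots k i h (f 0)).wl (oneF i h)).comp ((capEF k i h).comp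
        ((ccw B i b (-C.h i b.wt - 1 + f 1)).comp
          ((cupEF k i h).comp ((dots k i h (f 2)).wl (oneF i h)))))
    else [])

/-- The sum over `f₁ + f₂ + f₃ = -λ_i - 1` in the `sl₂` relation for `F_i E_i 1_λ`: a cap with `f₁`
dots, then a clockwise bubble with the label `λ_i - 1 + f₂`, then a cup with `f₃` dots. -/
def sumFE (B : BubbleParams k I X) {a b : Wt C} (i : I) (h : a.wt + C.α i = b.wt) :
    Tm k (oneE i h ≫ oneF i h) (oneE i h ≫ oneF i h) :=
  Term.listSum (if 0 ≤ -C.h i a.wt - 1 then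
    (List.Nat.antidiagonalTuple 3 (-C.h i a.wt - 1).toNat).map fun f =>
      ((dots k i h (f 0)).wr (oneF i h)).comp ((capFE k i h).comp
        ((cw B i a (C.h i a.wt - 1 + f 1)).comp
          ((cupFE k i h).comp ((dots k i h (f 2)).wr (oneF i h)))))
    else [])

end Tm

/-! ### Relations -/

open Tm in
/-- The defining relations. -/
inductive Rel (Q : Scalars k C) (B : BubbleParams k I X) :
    ∀ ⦃a b : Wt C⦄ ⦃f g : a ⟶ b⦄, Tm k f g → Tm k f g → Prop
  -- biadjointness
  | zigzag₁ {a b : Wt C} (i : I) (h : a.wt + C.α i = b.wt) :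
      Rel Q B ((Term.id (oneE i h)).vert (((cupFE k i h).wr (oneE i h)).vert
        (((capEF k i h).wl (oneE i h)).vert (Term.id (oneE i h))))) (Term.id (oneE i h))
  | zigzag₂ {a b : Wt C} (i : I) (h : a.wt + C.α i = b.wt) :
      Rel Q B ((Term.id (oneF i h)).vert (((cupFE k i h).wl (oneF i h)).vert
        (((capEF k i h).wr (oneF i h)).vert (Term.id (oneF i h))))) (Term.id (oneF i h))
  | zigzag₃ {a b : Wt C} (i : I) (h : a.wt + C.α i = b.wt) :
      Rel Q B ((Term.id (oneE i h)).vert (((cupEF k i h).wl (oneE i h)).vert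
        (((capFE k i h).wr (oneE i h)).vert (Term.id (oneE i h))))) (Term.id (oneE i h))
  | zigzag₄ {a b : Wt C} (i : I) (h : a.wt + C.α i = b.wt) :
      Rel Q B ((Term.id (oneF i h)).vert (((cupEF k i h).wr (oneF i h)).vert
        (((capFE k i h).wl (oneF i h)).vert (Term.id (oneF i h))))) (Term.id (oneF i h))
  -- cyclicity
  | dot_cyclic {a b : Wt C} (i : I) (h : a.wt + C.α i = b.wt) :
      Rel Q B (dotRot₁ k i h) (dotRot₂ k i h)
  | cross_cyclic {a b c d : Wt C} (i j : I) (hj : a.wt + C.α j = b.wt)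
      (hi : b.wt + C.α i = d.wt) (hi' : a.wt + C.α i = c.wt) (hj' : c.wt + C.α j = d.wt) :
      Rel Q B (crossRot₁ k i j hj hi hi' hj') (crossRot₂ k i j hj hi hi' hj')
  -- quadratic KLR relations
  | quad_self {a b c : Wt C} (i : I) (h : a.wt + C.α i = b.wt) (h' : b.wt + C.α i = c.wt) :
      Rel Q B ((cross k i i h h' h h').comp (cross k i i h h' h h')) (.zero _ _)
  | quad_zero {a b c d : Wt C} (i j : I) (hij : i ≠ j) (hj : a.wt + C.α j = b.wt)
      (hi : b.wt + C.α i = d.wt) (hi' : a.wt + C.α i = c.wt) (hj' : c.wt + C.α j = d.wt)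
      (ha : C.h i (C.α j) = 0) :
      Rel Q B ((cross k i j hj hi hi' hj').comp (cross k j i hi' hj' hj hi))
        ((Term.id (oneE j hj ≫ oneE i hi)).smul (Q.t i j hij : k))
  | quad_neg_one {a b c d : Wt C} (i j : I) (hij : i ≠ j) (hj : a.wt + C.α j = b.wt)
      (hi : b.wt + C.α i = d.wt) (hi' : a.wt + C.α i = c.wt) (hj' : c.wt + C.α j = d.wt)
      (ha : C.h i (C.α j) = -1) :
      Rel Q B ((cross k i j hj hi hi' hj').comp (cross k j i hi' hj' hj hi))
        ((((dot k i hi).wl (oneE j hj)).smul (Q.t i j hij : k)).plus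
          (((dot k j hj).wr (oneE i hi)).smul (Q.t j i hij.symm : k)))
  -- nilHecke dot sliding relations
  | nil_left {a b c : Wt C} (i : I) (h : a.wt + C.α i = b.wt) (h' : b.wt + C.α i = c.wt) :
      Rel Q B ((((dot k i h').wl (oneE i h)).comp (cross k i i h h' h h')).diff
        ((cross k i i h h' h h').comp ((dot k i h).wr (oneE i h')))) (Term.id _)
  | nil_right {a b c : Wt C} (i : I) (h : a.wt + C.α i = b.wt) (h' : b.wt + C.α i = c.wt) :
      Rel Q B (((cross k i i h h' h h').comp ((dot k i h').wl (oneE i h))).diff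
        (((dot k i h).wr (oneE i h')).comp (cross k i i h h' h h'))) (Term.id _)
  -- dot sliding for distinct labels
  | slide_left {a b c d : Wt C} (i j : I) (hij : i ≠ j) (hj : a.wt + C.α j = b.wt)
      (hi : b.wt + C.α i = d.wt) (hi' : a.wt + C.α i = c.wt) (hj' : c.wt + C.α j = d.wt) :
      Rel Q B (((dot k i hi).wl (oneE j hj)).comp (cross k i j hj hi hi' hj'))
        ((cross k i j hj hi hi' hj').comp ((dot k i hi').wr (oneE j hj')))
  | slide_right {a b c d : Wt C} (i j : I) (hij : i ≠ j) (hj : a.wt + C.α j = b.wt)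
      (hi : b.wt + C.α i = d.wt) (hi' : a.wt + C.α i = c.wt) (hj' : c.wt + C.α j = d.wt) :
      Rel Q B (((dot k j hj).wr (oneE i hi)).comp (cross k i j hj hi hi' hj'))
        ((cross k i j hj hi hi' hj').comp ((dot k j hj').wl (oneE i hi')))
  -- cubic KLR relations, with strands labelled `i`, `j`, `l` from left to right
  | cubic {a xi xj xl xij xil xjl x : Wt C} (i j l : I)
      (hai : a.wt + C.α i = xi.wt) (haj : a.wt + C.α j = xj.wt) (hal : a.wt + C.α l = xl.wt)
      (hij : xi.wt + C.α j = xij.wt) (hil : xi.wt + C.α l = xil.wt)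
      (hji : xj.wt + C.α i = xij.wt) (hjl : xj.wt + C.α l = xjl.wt)
      (hli : xl.wt + C.α i = xil.wt) (hlj : xl.wt + C.α j = xjl.wt)
      (hijl : xij.wt + C.α l = x.wt) (hilj : xil.wt + C.α j = x.wt) (hjli : xjl.wt + C.α i = x.wt)
      (hne : ¬(i = l ∧ C.h i (C.α j) = -1)) :
      Rel Q B
        (((cross k i j hlj hjli hli hilj).wl (oneE l hal)).vert
          (((cross k i l hal hli hai hil).wr (oneE j hilj)).vert
            ((cross k j l hil hilj hij hijl).wl (oneE i hai))))
        ((Term.id _).vert ((((cross k j l hal hlj haj hjl).wr (oneE i hjli)).vert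
          (((cross k i l hjl hjli hji hijl).wl (oneE j haj)).vert
            ((cross k i j haj hji hai hij).wr (oneE l hijl)))).vert (Term.id _)))
  | cubic_neg_one {a xi xj xii xij x : Wt C} (i j : I) (hne : i ≠ j)
      (hai : a.wt + C.α i = xi.wt) (haj : a.wt + C.α j = xj.wt)
      (hii : xi.wt + C.α i = xii.wt) (hij : xi.wt + C.α j = xij.wt)
      (hji : xj.wt + C.α i = xij.wt)
      (hiji : xij.wt + C.α i = x.wt) (hiij : xii.wt + C.α j = x.wt)
      (ha : C.h i (C.α j) = -1) :
      Rel Q B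
        ((((cross k i j hij hiji hii hiij).wl (oneE i hai)).vert
          (((cross k i i hai hii hai hii).wr (oneE j hiij)).vert
            ((cross k j i hii hiij hij hiji).wl (oneE i hai)))).diff
        ((Term.id _).vert ((((cross k j i hai hij haj hji).wr (oneE i hiji)).vert
          (((cross k i i hji hiji hji hiji).wl (oneE j haj)).vert
            ((cross k i j haj hji hai hij).wr (oneE i hiji)))).vert (Term.id _))))
        ((Term.id (oneE i hai ≫ oneE j hij ≫ oneE i hiji)).smul (Q.t i j hne : k))
  -- mixed relations
  | mixed_EF {a b c d : Wt C} (i j : I) (hne : i ≠ j) (hi : a.wt + C.α i = b.wt)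
      (hj : b.wt + C.α j = d.wt) (hj' : a.wt + C.α j = c.wt) (hi' : c.wt + C.α i = d.wt) :
      Rel Q B ((sideEF k i j hi hj hj' hi').comp (sideFE k j i hj' hi' hi hj)) (Term.id _)
  | mixed_FE {a b c d : Wt C} (i j : I) (hne : i ≠ j) (hi : a.wt + C.α i = b.wt)
      (hj : b.wt + C.α j = d.wt) (hj' : a.wt + C.α j = c.wt) (hi' : c.wt + C.α i = d.wt) :
      Rel Q B ((sideFE k j i hj' hi' hi hj).comp (sideEF k i j hi hj hj' hi')) (Term.id _)
  -- bubbles of negative degree and of degree zero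
  | cw_neg (i : I) (a : Wt C) (m : ℕ) (hm : (m : ℤ) < C.h i a.wt - 1) :
      Rel Q B (cwDots k i a m) (.zero _ _)
  | ccw_neg (i : I) (a : Wt C) (m : ℕ) (hm : (m : ℤ) < -C.h i a.wt - 1) :
      Rel Q B (ccwDots k i a m) (.zero _ _)
  | cw_zero (i : I) (a : Wt C) (m : ℕ) (hm : (m : ℤ) = C.h i a.wt - 1) :
      Rel Q B (cwDots k i a m) ((Term.id (𝟙 a)).smul (B.cp i a.wt : k))
  | ccw_zero (i : I) (a : Wt C) (m : ℕ) (hm : (m : ℤ) = -C.h i a.wt - 1) :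
      Rel Q B (ccwDots k i a m) ((Term.id (𝟙 a)).smul (B.cm i a.wt : k))
  -- the infinite Grassmannian relations
  | grassmannian (i : I) (a : Wt C) (n : ℕ) :
      Rel Q B (Term.listSum ((List.Nat.antidiagonal n).map fun p =>
          (cw B i a (C.h i a.wt - 1 + p.1)).comp (ccw B i a (-C.h i a.wt - 1 + p.2))))
        ((Term.id (𝟙 a)).smul (if n = 0 then -(↑(B.β i a.wt)⁻¹ : k) else 0))
  -- the `sl₂` relations
  | sl2_EF {a b c : Wt C} (i : I) (h : a.wt + C.α i = b.wt) (h' : b.wt + C.α i = c.wt) :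
      Rel Q B (Term.id (oneF i h ≫ oneE i h))
        ((((sideEF k i i h h' h h').comp (sideFE k i i h h' h h')).smul (B.β i b.wt : k)).diff
          ((sumEF B i h).smul (B.β i b.wt : k)))
  | sl2_FE {a b c : Wt C} (i : I) (h : a.wt + C.α i = b.wt) (h' : b.wt + C.α i = c.wt) :
      Rel Q B (Term.id (oneE i h' ≫ oneF i h'))
        ((((sideFE k i i h h' h h').comp (sideEF k i i h h' h h')).smul (B.β i b.wt : k)).diff
          ((sumFE B i h').smul (B.β i b.wt : k)))

/-- The presentation of the categorified quantum group. -/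
def pres (Q : Scalars k C) (B : BubbleParams k I X) : Presentation k (Wt C) where
  gen := Gen C
  deg := Gen.deg
  rel := Rel Q B

/-- The categorified quantum group `𝒰_{Q,β}(𝔤)`: a graded additive `k`-linear 2-category. -/
abbrev U (Q : Scalars k C) (B : BubbleParams k I X) := (pres Q B).Env

/-- A generating 2-morphism from `f` to `g` of degree `d`, as a 2-morphism `f ⟶ g⟨d⟩`. -/
def gen2 (Q : Scalars k C) (B : BubbleParams k I X) {a b : Wt C} {f g : a ⟶ b} (x : Gen C f g) :
    Presentation.Env.single (pres Q B) f ⟶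
      Presentation.Env.shift (Presentation.Env.single (pres Q B) g) x.deg :=
  Presentation.Env.ofTerm (T := pres Q B) (Term.gen x) (.gen x)

end Concrete

end CatQG

namespace CatQG

universe u v w t

/-! A strict `k`-linear 2-functor out of a 2-category presented by generators and relations is
determined by the images of the generators. It exists as soon as these have the right degrees and
satisfy the relations. Here each generator goes to a unit multiple of itself, so a diagram without
coefficients goes to itself times the product of the factors of its generators: a dot counts `D i`,
an upward `ii`-crossing counts `(D i)⁻¹`, everything else counts 1. A relation is preserved if all
its terms pick up one common factor, after the discrepancies have been absorbed into the
coefficients. The rescaled parameters are the coefficients that achieve this.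

The count is as follows. In the nilHecke relations a dot cancels a crossing. In the quadratic
relation with `i·j = -1` the dot contributes `D_i`, turning `t_ij` into `D_i t_ij`. In the
inhomogeneous cubic relation the single `ii`-crossing contributes `D_i⁻¹`, compensated by the same
change of `t_ij`. A bubble with `m` dots scales by `D_i^m`, so its degree-zero value `c^±`, at `m =
±λ_i - 1`, must be multiplied by `D_i^(∓λ_i + 1)`. A product of bubbles with labels `λ_i - 1 + x`
and `-λ_i - 1 + y` scales by `D_i^(x + y - 2)`, which fixes the power in `β` through the
Grassmannian relation. The same power appears in the `sl₂` relations, from two `ii`-crossings on one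
side and from dots and bubble labels adding up to -2 on the other.

Fake bubbles have coefficients that involve `c^±`, so their image is a multiple of the fake bubble
for the other parameters. That the factor is again `D_i^m` is an induction along their recursive
definition.

The inverse is the same construction for `D⁻¹`: rescaling the parameters by `D` and then by `D⁻¹`
restores them, and the factors of each generator cancel.

`Presentation.Hom.cong` reduces functoriality to the defining relations, and
`Presentation.Hom.strict` builds the 2-functor. The relation `ScalesTo` records factors and is
closed under all operations on diagrams. `ScalesTo.cong_of_rel` checks the relations, and
`Presentation.Hom.strict_comp_strict` reduces invertibility to generators. -/

theorem eq_conj_eqToHom {𝒞 : Type v} [Category.{w} 𝒞] {x y : 𝒞} (f : x ⟶ y) (p : x = x)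
    (q : y = y) : f = eqToHom p ≫ f ≫ eqToHom q := by
  simp

/-- In a strict pseudofunctor the comparison isomorphisms for identities and composites are
prescribed to be `eqToIso`s. They are therefore determined by the action on 1-morphisms, and all
other fields are propositions. -/
theorem _root_.CategoryTheory.StrictPseudofunctor.eq_of_toPrelaxFunctorStruct_eq
    {B : Type*} [Bicategory B] {C : Type*} [Bicategory C] {F G : StrictPseudofunctor B C}
    (h : F.toPrelaxFunctorStruct = G.toPrelaxFunctorStruct) : F = G := by
  obtain ⟨⟨⟨⟨F₀, _, _⟩, Fi, Fc, _, _, _, _, _⟩, _, hi⟩, _, hc⟩ := F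
  obtain ⟨⟨⟨⟨G₀, _, _⟩, Gi, Gc, _, _, _, _, _⟩, _, hi'⟩, _, hc'⟩ := G
  obtain rfl : F₀ = G₀ := h
  obtain rfl : @Fi = @Gi := by
    funext a; exact (hi a).trans (hi' a).symm
  obtain rfl : @Fc = @Gc := by
    funext a b c f g; exact (hc f g).trans (hc' f g).symm
  rfl

/-! ### 2-functors induced by morphisms of presentations -/

section PresentationHom

variable {k : Type u} {𝒞 : Type v} [Category.{w} 𝒞]

namespace Term

variable {G G' : ∀ ⦃a b : 𝒞⦄, (a ⟶ b) → (a ⟶ b) → Type t}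

/-- The extension to formal expressions of an assignment of formal expressions to generators. -/
def lift (m : ∀ ⦃a b : 𝒞⦄ ⦃f g : a ⟶ b⦄, G f g → Term k G' f g) :
    ∀ {a b : 𝒞} {f g : a ⟶ b}, Term k G f g → Term k G' f g
  | _, _, _, _, .gen x => m x
  | _, _, _, _, .id f => .id f
  | _, _, _, _, .comp s r => (s.lift m).comp (r.lift m)
  | _, _, _, _, .wl f s => (s.lift m).wl f
  | _, _, _, _, .wr s h => (s.lift m).wr h
  | _, _, _, _, .zero f g => .zero f g
  | _, _, _, _, .plus s r => (s.lift m).plus (r.lift m)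
  | _, _, _, _, .smul c s => (s.lift m).smul c

variable (m : ∀ ⦃a b : 𝒞⦄ ⦃f g : a ⟶ b⦄, G f g → Term k G' f g)

/-- Needed for the strict unit and associativity axioms of `Presentation.Cong`, which are stated
with transported identities. -/
theorem lift_eqTo {a b : 𝒞} {f g : a ⟶ b} (e : f = g) :
    (eqTo e : Term k G f g).lift m = eqTo e := by
  subst e; rfl

theorem HasDeg.lift {deg : ∀ ⦃a b : 𝒞⦄ ⦃f g : a ⟶ b⦄, G f g → ℤ}
    {deg' : ∀ ⦃a b : 𝒞⦄ ⦃f g : a ⟶ b⦄, G' f g → ℤ}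
    (hm : ∀ ⦃a b : 𝒞⦄ ⦃f g : a ⟶ b⦄ (x : G f g), (m x).HasDeg deg' (deg x))
    {a b : 𝒞} {f g : a ⟶ b} {s : Term k G f g} {d : ℤ} (h : s.HasDeg deg d) :
    (s.lift m).HasDeg deg' d := by
  induction h with
  | gen x => exact hm x
  | id f => exact .id f
  | comp _ _ ih ih' => exact .comp ih ih'
  | wl f _ ih => exact .wl f ih
  | wr h _ ih => exact .wr h ih
  | zero f g d => exact .zero f g d
  | plus _ _ ih ih' => exact .plus ih ih'
  | smul c _ ih => exact .smul c ih

end Term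

variable [CommRing k]

/-- A morphism of presentations that is the identity on 1-morphisms. -/
structure Presentation.Hom (T T' : Presentation.{u, v, w, t} k 𝒞) where
  /-- the images of the generators -/
  gen : ∀ ⦃a b : 𝒞⦄ ⦃f g : a ⟶ b⦄, T.gen f g → Term k T'.gen f g
  hasDeg : ∀ ⦃a b : 𝒞⦄ ⦃f g : a ⟶ b⦄ (x : T.gen f g), (gen x).HasDeg T'.deg (T.deg x)
  rel : ∀ ⦃a b : 𝒞⦄ ⦃f g : a ⟶ b⦄ {s r : Term k T.gen f g},
    T.rel s r → T'.Cong (s.lift gen) (r.lift gen)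

namespace Presentation.Hom

open Term

variable {T T' : Presentation.{u, v, w, t} k 𝒞} (F : T.Hom T')

/-- `Term.lift` commutes with every operation on formal expressions, so each axiom of a `k`-linear
strict 2-category is carried to an instance of itself. Only the clause `of`, for the defining
relations, uses information about `F`. -/
theorem cong {a b : 𝒞} {f g : a ⟶ b} {s r : Term k T.gen f g} (h : T.Cong s r) :
    T'.Cong (s.lift F.gen) (r.lift F.gen) := by
  induction h with
  | of h => exact F.rel h
  | refl s => exact .refl _
  | symm _ ih => exact .symm ih
  | trans _ _ ih ih' => exact .trans ih ih'
  | comp_congr _ _ ih ih' => exact .comp_congr ih ih'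
  | wl_congr f _ ih => exact .wl_congr f ih
  | wr_congr h _ ih => exact .wr_congr h ih
  | plus_congr _ _ ih ih' => exact .plus_congr ih ih'
  | smul_congr c _ ih => exact .smul_congr c ih
  | plus_comm s r => exact .plus_comm _ _
  | plus_assoc s r q => exact .plus_assoc _ _ _
  | zero_plus s => exact .zero_plus _
  | neg_plus s => exact .neg_plus _
  | smul_plus c s r => exact .smul_plus _ _ _
  | plus_smul c d s => exact .plus_smul _ _ _
  | mul_smul c d s => exact .mul_smul _ _ _
  | one_smul s => exact .one_smul _
  | plus_comp s s' r => exact .plus_comp _ _ _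
  | comp_plus s r r' => exact .comp_plus _ _ _
  | smul_comp c s r => exact .smul_comp _ _ _
  | comp_smul c s r => exact .comp_smul _ _ _
  | wl_plus f s r => exact .wl_plus _ _ _
  | wl_smul f x s => exact .wl_smul _ _ _
  | plus_wr h s r => exact .plus_wr _ _ _
  | smul_wr h x s => exact .smul_wr _ _ _
  | id_comp s => exact .id_comp _
  | comp_id s => exact .comp_id _
  | assoc s r q => exact .assoc _ _ _
  | wl_id f g => exact .wl_id _ _
  | wl_comp f s r => exact .wl_comp _ _ _
  | id_wr f g => exact .id_wr _ _
  | comp_wr s r i => exact .comp_wr _ _ _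
  | exchange s r => exact .exchange _ _
  | id_wl s => simpa only [Term.lift, lift_eqTo] using .id_wl _
  | wr_id s => simpa only [Term.lift, lift_eqTo] using .wr_id _
  | wl_wl f g s => simpa only [Term.lift, lift_eqTo] using .wl_wl _ _ _
  | wr_wr s g h => simpa only [Term.lift, lift_eqTo] using .wr_wr _ _ _
  | wl_wr f s h => simpa only [Term.lift, lift_eqTo] using .wl_wr _ _ _

/-- The map on classes of formal expressions. -/
def two {a b : 𝒞} (f g : a ⟶ b) : Star.TwoHom T f g →ₗ[k] Star.TwoHom T' f g where
  toFun := Quot.map (fun s => s.lift F.gen) fun _ _ => F.cong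
  map_add' := by rintro ⟨s⟩ ⟨r⟩; rfl
  map_smul' := by rintro c ⟨s⟩; rfl

/-- The map on 2-morphisms between 1-morphisms of the 2-category presented by `T`. -/
def star {a b : T.Star} {f g : a ⟶ b} (s : f ⟶ g) :
    @Quiver.Hom ((⟨a.as⟩ : T'.Star) ⟶ ⟨b.as⟩) _ f g :=
  F.two (a := a.as) (b := b.as) f g s

theorem star_mem {a b : T.Star} {f g : a ⟶ b} {s : f ⟶ g} {d : ℤ} (h : s ∈ Star.homog f g d) :
    F.star s ∈ Star.homog (T := T') (a := ⟨a.as⟩) (b := ⟨b.as⟩) f g d := by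
  obtain ⟨s, hs, rfl⟩ := h
  exact ⟨_, hs.lift _ F.hasDeg, rfl⟩

theorem star_add {a b : T.Star} {f g : a ⟶ b} (s r : f ⟶ g) :
    F.star (s + r) = F.star s + F.star r := map_add (F.two (a := a.as) (b := b.as) f g) s r

theorem star_smul {a b : T.Star} {f g : a ⟶ b} (c : k) (s : f ⟶ g) :
    F.star (c • s) = c • F.star s := map_smul (F.two (a := a.as) (b := b.as) f g) c s

theorem star_zero {a b : T.Star} (f g : a ⟶ b) : F.star (0 : f ⟶ g) = 0 :=
  map_zero (F.two (a := a.as) (b := b.as) f g)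

theorem star_sum {a b : T.Star} {f g : a ⟶ b} {ι : Type} (A : Finset ι) (s : ι → (f ⟶ g)) :
    F.star (∑ i ∈ A, s i) = ∑ i ∈ A, F.star (s i) :=
  map_sum (F.two (a := a.as) (b := b.as) f g) s A

theorem star_comp {a b : T.Star} {f g h : a ⟶ b} (s : f ⟶ g) (r : g ⟶ h) :
    F.star (s ≫ r) = F.star s ≫ F.star r := by
  obtain ⟨s⟩ := s; obtain ⟨r⟩ := r; rfl

theorem star_whiskerLeft {a b c : T.Star} (f : a ⟶ b) {g h : b ⟶ c} (s : g ⟶ h) :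
    F.star (f ◁ s) = whiskerLeft (B := T'.Star) (a := ⟨a.as⟩) (b := ⟨b.as⟩) f (F.star s) := by
  obtain ⟨s⟩ := s; rfl

theorem star_whiskerRight {a b c : T.Star} {f g : a ⟶ b} (s : f ⟶ g) (h : b ⟶ c) :
    F.star (s ▷ h) = whiskerRight (B := T'.Star) (b := ⟨b.as⟩) (c := ⟨c.as⟩) (F.star s) h := by
  obtain ⟨s⟩ := s; rfl

theorem star_eqToHom {a b : T.Star} {f g : a ⟶ b} (e : f = g) :
    F.star (eqToHom e) = @eqToHom ((⟨a.as⟩ : T'.Star) ⟶ ⟨b.as⟩) _ f g e := by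
  subst e; rfl

open Env

/-- The map on 2-morphisms of graded additive 2-categories: apply `F` to the entries. -/
def env {a b : T.Env} {x y : a ⟶ b} (s : x ⟶ y) :
    (idOne T T').map x ⟶ (idOne T T').map y where
  entry i j := F.star (TwoMor.entry (x := x) (y := y) s i j)
  mem i j := F.star_mem (TwoMor.mem (x := x) (y := y) s i j)

theorem env_add {a b : T.Env} {x y : a ⟶ b} (s r : x ⟶ y) :
    F.env (s + r) = F.env s + F.env r :=
  TwoMor.ext (funext fun _ => funext fun _ => F.star_add _ _)

theorem env_smul {a b : T.Env} {x y : a ⟶ b} (c : k) (s : x ⟶ y) :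
    F.env (c • s) = c • F.env s :=
  TwoMor.ext (funext fun _ => funext fun _ => F.star_smul _ _)

/-- The degree condition in `TwoMor.mono` depends on the entries, so the entries are replaced
together with its proof. -/
theorem _root_.CatQG.Presentation.Env.TwoMor.mono_congr {a b : T.Env} {x y : OneMor a b}
    (σ : x.ι ≃ y.ι) {θ θ' : ∀ i, x.word i ⟶ y.word (σ i)} (h : θ = θ')
    (hθ : ∀ i, θ i ∈ Star.homog _ _ (y.shift (σ i) - x.shift i))
    (hθ' : ∀ i, θ' i ∈ Star.homog _ _ (y.shift (σ i) - x.shift i)) :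
    TwoMor.mono σ θ hθ = TwoMor.mono σ θ' hθ' := by
  subst h; rfl

/-- Identities, unitors and associators of direct sums are all monomial matrices. This one
computation therefore gives their preservation, once their entries are known to be preserved. -/
theorem env_mono {a b : T.Env} {x y : OneMor a b} (σ : x.ι ≃ y.ι)
    (θ : ∀ i, x.word i ⟶ y.word (σ i))
    (hθ : ∀ i, θ i ∈ Star.homog _ _ (y.shift (σ i) - x.shift i)) :
    F.env (x := x) (y := y) (TwoMor.mono σ θ hθ) =
      TwoMor.mono (x := (idOne T T').map x) (y := (idOne T T').map y) σ (fun i => F.star (θ i))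
        (fun i => F.star_mem (hθ i)) := by
  refine TwoMor.ext (funext fun i : x.ι => funext fun j : y.ι => ?_)
  by_cases h : σ i = j
  · subst h
    exact (congrArg F.star (TwoMor.mono_entry_self σ θ hθ i)).trans
      (TwoMor.mono_entry_self (x := (idOne T T').map x) (y := (idOne T T').map y) σ
        (fun i => F.star (θ i)) _ i).symm
  · exact (congrArg F.star (TwoMor.mono_entry_ne σ θ hθ h)).trans ((F.star_zero _ _).trans
      (TwoMor.mono_entry_ne (x := (idOne T T').map x) (y := (idOne T T').map y) σ
        (fun i => F.star (θ i)) _ h).symm)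

theorem env_id {a b : T.Env} (x : a ⟶ b) : F.env (𝟙 x) = 𝟙 ((idOne T T').map x) :=
  F.env_mono (x := x) (y := x) (Equiv.refl _) (fun _ => 𝟙 _)
    fun i => (sub_self (OneMor.shift x i)).symm ▸ Star.id_mem (OneMor.word x i)

theorem env_comp {a b : T.Env} {x y z : a ⟶ b} (s : x ⟶ y) (r : y ⟶ z) :
    F.env (s ≫ r) = F.env s ≫ F.env r := by
  refine TwoMor.ext (funext fun i => funext fun j => ?_)
  refine (F.star_sum (f := OneMor.word x i) (g := OneMor.word z j) Finset.univ _).trans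
    (Finset.sum_congr rfl fun (l : OneMor.ι y) _ => F.star_comp _ _)

theorem env_whiskerLeft {a b c : T.Env} (x : a ⟶ b) {y z : b ⟶ c} (s : y ⟶ z) :
    F.env (x ◁ s) = (idOne T T').map x ◁ F.env s := by
  refine TwoMor.ext (funext fun p => funext fun q => ?_)
  obtain ⟨i, j⟩ := p; obtain ⟨i', j'⟩ := q
  by_cases h : i = i'
  · subst h
    refine (congrArg F.star (TwoMor.wL_entry_self x s i j j')).trans ?_
    refine (F.star_whiskerLeft _ _).trans ?_
    exact (TwoMor.wL_entry_self ((idOne T T').map x) (F.env s) i j j').symm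
  · refine (congrArg F.star (TwoMor.wL_entry_ne x s h j j')).trans ((F.star_zero _ _).trans ?_)
    exact (TwoMor.wL_entry_ne ((idOne T T').map x) (F.env s) h j j').symm

theorem env_whiskerRight {a b c : T.Env} {x y : a ⟶ b} (s : x ⟶ y) (z : b ⟶ c) :
    F.env (s ▷ z) = F.env s ▷ (idOne T T').map z := by
  refine TwoMor.ext (funext fun p => funext fun q => ?_)
  obtain ⟨i, j⟩ := p; obtain ⟨i', j'⟩ := q
  by_cases h : j = j'
  · subst h
    refine (congrArg F.star (TwoMor.wR_entry_self s z i i' j)).trans ?_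
    refine (F.star_whiskerRight _ _).trans ?_
    exact (TwoMor.wR_entry_self (F.env s) ((idOne T T').map z) i i' j).symm
  · refine (congrArg F.star (TwoMor.wR_entry_ne s z i i' h)).trans ((F.star_zero _ _).trans ?_)
    exact (TwoMor.wR_entry_ne (F.env s) ((idOne T T').map z) i i' h).symm

theorem env_leftUnitor {a b : T.Env} (x : a ⟶ b) :
    F.env (λ_ x).hom = (λ_ ((idOne T T').map x)).hom := by
  refine (F.env_mono _ _ (leftRe x).hom_mem).trans ?_
  refine TwoMor.mono_congr _ ?_ _ (leftRe ((idOne T T').map x)).hom_mem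
  -- Words compose strictly, so the entries of a unitor or associator are `eqToHom`s, which every
  -- `F` preserves.
  exact funext fun p => F.star_eqToHom (Star.hom_id_comp _)

theorem env_rightUnitor {a b : T.Env} (x : a ⟶ b) :
    F.env (ρ_ x).hom = (ρ_ ((idOne T T').map x)).hom := by
  refine (F.env_mono _ _ (rightRe x).hom_mem).trans ?_
  refine TwoMor.mono_congr _ ?_ _ (rightRe ((idOne T T').map x)).hom_mem
  exact funext fun p => F.star_eqToHom (Star.hom_comp_id _)

theorem env_associator {a b c d : T.Env} (x : a ⟶ b) (y : b ⟶ c) (z : c ⟶ d) :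
    F.env (α_ x y z).hom =
      (α_ ((idOne T T').map x) ((idOne T T').map y) ((idOne T T').map z)).hom := by
  refine (F.env_mono _ _ (assocRe x y z).hom_mem).trans ?_
  refine TwoMor.mono_congr _ ?_ _
    (assocRe ((idOne T T').map x) ((idOne T T').map y) ((idOne T T').map z)).hom_mem
  exact funext fun p => F.star_eqToHom (Star.hom_assoc _ _ _)

/-- The strict 2-functor induced by a morphism of presentations. -/
noncomputable def strict : StrictPseudofunctor T.Env T'.Env :=
  .mk' {
    toPrefunctor := idOne T T'
    map₂ := F.env
    map₂_id := F.env_id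
    map₂_comp := F.env_comp
    map_id := fun _ => rfl
    map_comp := fun _ _ => rfl
    -- On 1-morphisms `idOne` preserves identities and composites by `rfl`. The `eqToHom`s in the
    -- strict coherence conditions are then identities and may be inserted freely.
    map₂_whisker_left := fun x _ _ s =>
      (F.env_whiskerLeft x s).trans (eq_conj_eqToHom _ _ _)
    map₂_whisker_right := fun s z =>
      (F.env_whiskerRight s z).trans (eq_conj_eqToHom _ _ _)
    map₂_left_unitor := fun x =>
      (F.env_leftUnitor x).trans (Category.id_comp _).symm
    map₂_right_unitor := fun x =>
      (F.env_rightUnitor x).trans (Category.id_comp _).symm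
    map₂_associator := fun x y z =>
      (F.env_associator x y z).trans (eq_conj_eqToHom _ _ _) }

theorem strict_toPrelaxFunctorStruct :
    F.strict.toPrelaxFunctorStruct = { toPrefunctor := idOne T T', map₂ := F.env } := rfl

/-- Both lifts commute with all operations, so being mutually inverse up to congruence is a
condition on generators alone. -/
theorem lift_lift_cong (F' : T'.Hom T)
    (h : ∀ ⦃a b : 𝒞⦄ ⦃f g : a ⟶ b⦄ (x : T.gen f g), T.Cong ((F.gen x).lift F'.gen) (.gen x))
    {a b : 𝒞} {f g : a ⟶ b} (s : Term k T.gen f g) :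
    T.Cong ((s.lift F.gen).lift F'.gen) s := by
  induction s with
  | gen x => exact h x
  | id f => exact .refl _
  | comp s r ih ih' => exact .comp_congr ih ih'
  | wl f s ih => exact .wl_congr f ih
  | wr s h ih => exact .wr_congr h ih
  | zero f g => exact .refl _
  | plus s r ih ih' => exact .plus_congr ih ih'
  | smul c s ih => exact .smul_congr c ih

theorem star_star (F' : T'.Hom T)
    (h : ∀ ⦃a b : 𝒞⦄ ⦃f g : a ⟶ b⦄ (x : T.gen f g), T.Cong ((F.gen x).lift F'.gen) (.gen x))
    {a b : T.Star} {f g : a ⟶ b} (s : f ⟶ g) :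
    F'.star (a := ⟨a.as⟩) (b := ⟨b.as⟩) (f := f) (g := g) (F.star s) = s := by
  obtain ⟨s⟩ := s
  exact Star.sound (F.lift_lift_cong F' h s)

theorem strict_comp_strict (F' : T'.Hom T)
    (h : ∀ ⦃a b : 𝒞⦄ ⦃f g : a ⟶ b⦄ (x : T.gen f g), T.Cong ((F.gen x).lift F'.gen) (.gen x)) :
    F.strict.comp F'.strict = StrictPseudofunctor.id T.Env := by
  have hs : ∀ {a b : T.Env} {x y : a ⟶ b} (s : x ⟶ y), F'.env (F.env s) = s := fun {a b x y} s => by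
    refine TwoMor.ext (funext fun i => funext fun j => ?_)
    exact F.star_star F' h (TwoMor.entry (x := x) (y := y) s i j)
  refine StrictPseudofunctor.eq_of_toPrelaxFunctorStruct_eq ?_
  -- The composite of the two maps `idOne` is the identity by structure eta. Only the actions on
  -- 2-morphisms remain to be compared, and there no transport is needed.
  change PrelaxFunctorStruct.mk (Prefunctor.mk (fun a : T.Env => a) (fun x => x))
    (fun s => F'.env (F.env s)) = PrelaxFunctorStruct.mk (Prefunctor.mk (fun a => a) (fun x => x))
    (fun s => s)
  exact congrArg _ (by funext a b x y s; exact hs s)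

end Presentation.Hom

end PresentationHom

/-! ### Rescaled parameters and factors of diagrams -/

section Rescaling

variable {k : Type w} [CommRing k] {I : Type u} {X : Type v} [AddCommGroup X]

theorem CartanDatum.h_α_symm (C : CartanDatum I X) (i j : I) : C.h i (C.α j) = C.h j (C.α i) := by
  have := C.form_symm i j
  rw [← C.h_eq_form, ← C.h_eq_form] at this
  exact_mod_cast this

theorem CartanDatum.h_α_self (C : CartanDatum I X) (i : I) : C.h i (C.α i) = 2 := by
  have := C.form_self i
  rw [← C.h_eq_form] at this
  exact_mod_cast this

theorem CartanDatum.h_α_ne (C : CartanDatum I X) {i j : I} (h : i ≠ j) :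
    C.h i (C.α j) = 0 ∨ C.h i (C.α j) = -1 := by
  have := C.form_ne i j h
  rw [← C.h_eq_form] at this
  exact_mod_cast this

variable {C : CartanDatum I X}

/-- Passing from `λ` to `λ ± α_j` changes the exponent `∓λ_i + 1` of `D_i` by `-a_ij`, which is 0, 1
or -2. This is exactly the power of `D_i` by which `t_ij`, respectively `t_ii = -β`, is rescaled. In
the product of `c⁺` and `c⁻` the two exponents add up to 2, the exponent in the inverse of the new
`β`. -/
theorem Compatible.rescale {Q : Scalars k C} {B : BubbleParams k I X} (h : Compatible Q B)
    (D : I → kˣ) : Compatible (Q.rescale D) (B.rescale C D) where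
  mul_eq i x := by
    change D i ^ (-C.h i x + 1) * B.cp i x * (D i ^ (C.h i x + 1) * B.cm i x) =
      -(D i ^ (-2 : ℤ) * B.β i x)⁻¹
    rw [mul_mul_mul_comm, h.mul_eq, ← zpow_add, mul_inv, ← zpow_neg, mul_neg]
    congr 3; ring
  cp_add i j hij x := by
    change D i ^ (-C.h i (x + C.α j) + 1) * B.cp i (x + C.α j) =
      (if C.h i (C.α j) = -1 then D i * Q.t i j hij else Q.t i j hij) *
        (D i ^ (-C.h i x + 1) * B.cp i x)
    rw [h.cp_add i j hij, map_add]
    rcases C.h_α_ne hij with h0 | h0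
    · rw [if_neg (by omega), h0, add_zero, mul_left_comm]
    · rw [if_pos h0, h0, mul_mul_mul_comm, ← zpow_one_add]
      congr 2; ring
  cm_sub i j hij x := by
    change D i ^ (C.h i (x - C.α j) + 1) * B.cm i (x - C.α j) =
      (if C.h i (C.α j) = -1 then D i * Q.t i j hij else Q.t i j hij) *
        (D i ^ (C.h i x + 1) * B.cm i x)
    rw [h.cm_sub i j hij, map_sub]
    rcases C.h_α_ne hij with h0 | h0
    · rw [if_neg (by omega), h0, sub_zero, mul_left_comm]
    · rw [if_pos h0, h0, mul_mul_mul_comm, ← zpow_one_add]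
      congr 2; ring
  cp_add_self i x := by
    change D i ^ (-C.h i (x + C.α i) + 1) * B.cp i (x + C.α i) =
      -(D i ^ (-2 : ℤ) * B.β i x) * (D i ^ (-C.h i x + 1) * B.cp i x)
    rw [h.cp_add_self, map_add, C.h_α_self, ← mul_neg, mul_mul_mul_comm, ← zpow_add]
    congr 2; ring
  cm_sub_self i x := by
    change D i ^ (C.h i (x - C.α i) + 1) * B.cm i (x - C.α i) =
      -(D i ^ (-2 : ℤ) * B.β i x) * (D i ^ (C.h i x + 1) * B.cm i x)
    rw [h.cm_sub_self, map_sub, C.h_α_self, ← mul_neg, mul_mul_mul_comm, ← zpow_add]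
    congr 2; ring

/-- The case distinction in `Scalars.rescale` depends only on the Cartan integers, not on the
scalars, so both rescalings take the same branch and cancel. -/
theorem Scalars.rescale_rescale_inv (Q : Scalars k C) (D : I → kˣ) :
    (Q.rescale D).rescale D⁻¹ = Q := by
  obtain ⟨t, _⟩ := Q
  simp only [Scalars.rescale, Scalars.mk.injEq]
  funext i j hij
  split_ifs <;> simp

theorem BubbleParams.rescale_rescale_inv (C : CartanDatum I X) (B : BubbleParams k I X)
    (D : I → kˣ) : (B.rescale C D).rescale C D⁻¹ = B := by
  obtain ⟨β, cp, cm⟩ := B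
  simp only [BubbleParams.rescale, Pi.inv_apply, inv_zpow, inv_mul_cancel_left]

open scoped Classical in
/-- The factor by which a generator is rescaled: `D i` for an `i`-dot, `(D i)⁻¹` for an
`ii`-crossing, and `1` otherwise. -/
noncomputable def Gen.factor (D : I → kˣ) : ∀ ⦃a b : Wt C⦄ ⦃f g : a ⟶ b⦄, Gen C f g → kˣ
  | _, _, _, _, .dot i _ => D i
  | _, _, _, _, .cross i j _ _ _ _ => if i = j then (D i)⁻¹ else 1
  | _, _, _, _, .cupFE _ _ => 1
  | _, _, _, _, .cupEF _ _ => 1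
  | _, _, _, _, .capFE _ _ => 1
  | _, _, _, _, .capEF _ _ => 1

/-- The rescaled generator. -/
noncomputable def Gen.rescale (D : I → kˣ) ⦃a b : Wt C⦄ ⦃f g : a ⟶ b⦄ (x : Gen C f g) : Tm k f g :=
  (Term.gen x).smul (x.factor D : k)

/-- Rescaling the generators in `s` gives `c` times `s'`, modulo the relations for `Q` and `B`. -/
def ScalesTo (Q : Scalars k C) (B : BubbleParams k I X) (D : I → kˣ) {a b : Wt C} {f g : a ⟶ b}
    (s s' : Tm k f g) (c : kˣ) : Prop :=
  (pres Q B).Cong (s.lift (Gen.rescale D)) (s'.smul (c : k))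

/-! ### Calculus of scaling factors -/

namespace ScalesTo

open Presentation

variable {Q : Scalars k C} {B : BubbleParams k I X} {D : I → kˣ} {a b c : Wt C}

theorem cast {f g : a ⟶ b} {s s' : Tm k f g} {x y : kˣ} (h : ScalesTo Q B D s s' x)
    (e : x = y) : ScalesTo Q B D s s' y := e ▸ h

theorem gen {f g : a ⟶ b} (x : Gen C f g) :
    ScalesTo Q B D (.gen x) (.gen x) (x.factor D) := Cong.refl _

theorem id (f : a ⟶ b) : ScalesTo Q B D (.id f) (.id f) 1 :=
  Cong.symm (Cong.one_smul _)

theorem eqTo {f g : a ⟶ b} (e : f = g) : ScalesTo Q B D (Term.eqTo e) (Term.eqTo e) 1 := by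
  subst e; exact .id f

/-- Zero has every factor, so a vanishing side of a relation imposes no constraint. The congruence
has no clause for multiples of zero, and the claim is read off from the module of classes. -/
theorem zero (f g : a ⟶ b) (x : kˣ) : ScalesTo Q B D (.zero f g) (.zero f g) x := by
  -- Equality in a `Quot` gives only the generated equivalence relation, which here is the
  -- congruence itself because that is already an equivalence.
  have h : Star.cls (T := pres Q B) (.zero f g) = Star.cls (.smul (x : k) (.zero f g)) :=
    (smul_zero (x : k) (A := Star.TwoHom (pres Q B) f g)).symm
  exact ((Equivalence.mk Cong.refl Cong.symm Cong.trans).eqvGen_iff).1 (Quot.eqvGen_exact h)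

theorem comp {f g h : a ⟶ b} {s s' : Tm k f g} {r r' : Tm k g h} {x y : kˣ}
    (hs : ScalesTo Q B D s s' x) (hr : ScalesTo Q B D r r' y) :
    ScalesTo Q B D (s.comp r) (s'.comp r') (x * y) :=
  Cong.trans (Cong.comp_congr hs hr) <| Cong.trans (Cong.smul_comp _ _ _) <|
    Cong.trans (Cong.smul_congr _ (Cong.comp_smul _ _ _)) <| by
      rw [Units.val_mul]; exact Cong.symm (Cong.mul_smul _ _ _)

theorem vert {f g g' h : a ⟶ b} {s s' : Tm k f g} {r r' : Tm k g' h} {x y : kˣ} {e : g = g'}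
    (hs : ScalesTo Q B D s s' x) (hr : ScalesTo Q B D r r' y) :
    ScalesTo Q B D (s.vert r e) (s'.vert r' e) (x * y) :=
  (hs.comp ((eqTo e).comp hr)).cast (by rw [one_mul])

theorem wl (f : a ⟶ b) {g h : b ⟶ c} {s s' : Tm k g h} {x : kˣ} (hs : ScalesTo Q B D s s' x) :
    ScalesTo Q B D (s.wl f) (s'.wl f) x :=
  Cong.trans (Cong.wl_congr f hs) (Cong.wl_smul _ _ _)

theorem wr {f g : a ⟶ b} {s s' : Tm k f g} (h : b ⟶ c) {x : kˣ} (hs : ScalesTo Q B D s s' x) :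
    ScalesTo Q B D (s.wr h) (s'.wr h) x :=
  Cong.trans (Cong.wr_congr h hs) (Cong.smul_wr _ _ _)

theorem plus {f g : a ⟶ b} {s s' r r' : Tm k f g} {x : kˣ} (hs : ScalesTo Q B D s s' x)
    (hr : ScalesTo Q B D r r' x) : ScalesTo Q B D (s.plus r) (s'.plus r') x :=
  Cong.trans (Cong.plus_congr hs hr) (Cong.symm (Cong.smul_plus _ _ _))

/-- The rule that lets a coefficient change. It absorbs a discrepancy of factors into the passage
from a parameter to its rescaled value. -/
theorem smul {f g : a ⟶ b} {s s' : Tm k f g} {x z : kˣ} {y y' : k} (hs : ScalesTo Q B D s s' x)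
    (e : y * x = z * y') : ScalesTo Q B D (s.smul y) (s'.smul y') z :=
  Cong.trans (Cong.smul_congr y hs) <| Cong.trans (Cong.symm (Cong.mul_smul _ _ _)) <| by
    rw [e]; exact Cong.mul_smul _ _ _

theorem diff {f g : a ⟶ b} {s s' r r' : Tm k f g} {x : kˣ} (hs : ScalesTo Q B D s s' x)
    (hr : ScalesTo Q B D r r' x) : ScalesTo Q B D (s.diff r) (s'.diff r') x :=
  hs.plus (hr.smul (mul_comm _ _))

theorem listSum {f g : a ⟶ b} {ι : Type*} (l : List ι) {s s' : ι → Tm k f g} {x : kˣ}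
    (h : ∀ i ∈ l, ScalesTo Q B D (s i) (s' i) x) :
    ScalesTo Q B D (Term.listSum (l.map s)) (Term.listSum (l.map s')) x := by
  induction l with
  | nil => exact .zero _ _ _
  | cons i l ih =>
    exact (h i (List.mem_cons_self ..)).plus (ih fun j hj => h j (List.mem_cons_of_mem _ hj))

/-- If both sides of a relation acquire one common factor `x` and become the two sides of a relation
for the target parameters, then their images agree: they are `x` times the sides of a valid
relation. -/
theorem cong {f g : a ⟶ b} {s s' r r' : Tm k f g} {x : kˣ} (hs : ScalesTo Q B D s s' x)
    (hr : ScalesTo Q B D r r' x) (h : Rel Q B s' r') :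
    (pres Q B).Cong (s.lift (Gen.rescale D)) (r.lift (Gen.rescale D)) :=
  Cong.trans hs <| Cong.trans (Cong.smul_congr _ (Cong.of h)) (Cong.symm hr)

variable {d : Wt C}

theorem dot (i : I) (h : a.wt + C.α i = b.wt) :
    ScalesTo Q B D (Tm.dot k i h) (Tm.dot k i h) (D i) := gen _

theorem cross_self (i : I) {h₁ : a.wt + C.α i = b.wt} {h₂ : b.wt + C.α i = d.wt}
    {h₃ : a.wt + C.α i = c.wt} {h₄ : c.wt + C.α i = d.wt} :
    ScalesTo Q B D (Tm.cross k i i h₁ h₂ h₃ h₄) (Tm.cross k i i h₁ h₂ h₃ h₄) (D i)⁻¹ :=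
  (gen _).cast (if_pos rfl)

theorem cross_ne {i j : I} (hij : i ≠ j) {h₁ : a.wt + C.α j = b.wt} {h₂ : b.wt + C.α i = d.wt}
    {h₃ : a.wt + C.α i = c.wt} {h₄ : c.wt + C.α j = d.wt} :
    ScalesTo Q B D (Tm.cross k i j h₁ h₂ h₃ h₄) (Tm.cross k i j h₁ h₂ h₃ h₄) 1 :=
  (gen _).cast (if_neg hij)

-- A uniform factor for relations that do not separate equal from distinct labels: cyclicity and the
-- homogeneous cubic relation.
open scoped Classical in
theorem cross (i j : I) {h₁ : a.wt + C.α j = b.wt} {h₂ : b.wt + C.α i = d.wt}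
    {h₃ : a.wt + C.α i = c.wt} {h₄ : c.wt + C.α j = d.wt} :
    ScalesTo Q B D (Tm.cross k i j h₁ h₂ h₃ h₄) (Tm.cross k i j h₁ h₂ h₃ h₄)
      (if i = j then (D i)⁻¹ else 1) := gen _

theorem cupFE (i : I) (h : a.wt + C.α i = b.wt) :
    ScalesTo Q B D (Tm.cupFE k i h) (Tm.cupFE k i h) 1 := gen _

theorem cupEF (i : I) (h : a.wt + C.α i = b.wt) :
    ScalesTo Q B D (Tm.cupEF k i h) (Tm.cupEF k i h) 1 := gen _

theorem capFE (i : I) (h : a.wt + C.α i = b.wt) :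
    ScalesTo Q B D (Tm.capFE k i h) (Tm.capFE k i h) 1 := gen _

theorem capEF (i : I) (h : a.wt + C.α i = b.wt) :
    ScalesTo Q B D (Tm.capEF k i h) (Tm.capEF k i h) 1 := gen _

theorem dots (i : I) (h : a.wt + C.α i = b.wt) (n : ℕ) :
    ScalesTo Q B D (Tm.dots k i h n) (Tm.dots k i h n) (D i ^ n) := by
  induction n with
  | zero => exact (id _).cast (pow_zero _).symm
  | succ n ih => exact (ih.comp (dot i h)).cast (pow_succ _ _).symm

/-- The cup and the cap that turn the crossing sideways have factor 1, so only the upward crossing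
counts. -/
theorem sideEF {i j : I} {hi : a.wt + C.α i = b.wt} {hj : b.wt + C.α j = d.wt}
    {hj' : a.wt + C.α j = c.wt} {hi' : c.wt + C.α i = d.wt} {x : kˣ}
    (h : ScalesTo Q B D (Tm.cross k j i hi hj hj' hi') (Tm.cross k j i hi hj hj' hi') x) :
    ScalesTo Q B D (Tm.sideEF k i j hi hj hj' hi') (Tm.sideEF k i j hi hj hj' hi') x :=
  ((id _).vert (((cupFE _ _).wl _).vert (((h.wr _).wl _).vert
    (((capEF _ _).wr _).vert (id _))))).cast (by simp only [one_mul, mul_one])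

theorem sideFE {i j : I} {hi : a.wt + C.α i = b.wt} {hj : b.wt + C.α j = d.wt}
    {hj' : a.wt + C.α j = c.wt} {hi' : c.wt + C.α i = d.wt} {x : kˣ}
    (h : ScalesTo Q B D (Tm.cross k j i hi hj hj' hi') (Tm.cross k j i hi hj hj' hi') x) :
    ScalesTo Q B D (Tm.sideFE k i j hi hj hj' hi') (Tm.sideFE k i j hi hj hj' hi') x :=
  ((id _).vert (((cupEF _ _).wr _).vert (((h.wr _).wl _).vert
    (((capFE _ _).wl _).vert (id _))))).cast (by simp only [one_mul, mul_one])

theorem cwDots (i : I) (a : Wt C) (m : ℕ) :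
    ScalesTo Q B D (Tm.cwDots k i a m) (Tm.cwDots k i a m) (D i ^ m) :=
  ((cupEF _ _).comp (((dots _ _ m).wl _).comp (capEF _ _))).cast (by simp only [one_mul, mul_one])

theorem ccwDots (i : I) (a : Wt C) (m : ℕ) :
    ScalesTo Q B D (Tm.ccwDots k i a m) (Tm.ccwDots k i a m) (D i ^ m) :=
  ((cupFE _ _).comp (((dots _ _ m).wr _).comp (capFE _ _))).cast (by simp only [one_mul, mul_one])

/-- The exponent is the label of the fake bubble. In the recursion the labels of each product have a
sum independent of the summand, and the prefactor `1 / c⁻` supplies the missing power of `D i`. The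
bound `hn` says that the label is negative, which ensures that every `toNat` in the recursion is
applied to a nonnegative integer. -/
theorem cwFake (B₀ : BubbleParams k I X) (i : I) (a : Wt C) (n : ℕ) (hn : C.h i a.wt - 1 + n < 0) :
    ScalesTo Q B D (Tm.cwFake B₀ i a n) (Tm.cwFake (B₀.rescale C D) i a n)
      (D i ^ (C.h i a.wt - 1 + n)) := by
  induction n using Nat.strong_induction_on with
  | _ n ih =>
    cases n with
    | zero =>
      rw [Tm.cwFake, Tm.cwFake]
      refine (id _).smul ?_
      rw [Units.val_one, mul_one, ← Units.val_mul]
      change _ = ((_ * (D i ^ (-C.h i a.wt + 1) * B₀.cp i a.wt) : kˣ) : k)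
      -- The exponents `λ_i - 1` and `-λ_i + 1` cancel.
      rw [← mul_assoc, ← zpow_add]
      simp
    | succ n =>
      rw [Tm.cwFake, Tm.cwFake]
      -- The index `y` starts at 0, so the labels in a summand are `λ_i - 1 + n - y` and `-λ_i - 1 +
      -- (y + 1)`, with sum `n - 1`.
      refine smul (x := D i ^ (n - 1 : ℤ)) (listSum _ fun y _ => ?_) ?_
      · have hy := y.isLt
        refine ((ih (n - y.val) (by omega) (by omega)).comp (ccwDots _ _ _)).cast ?_
        rw [← zpow_natCast, ← zpow_add]
        congr 1
        omega
      -- The old `1 / c⁻` is `D_i^(λ_i + 1)` times the new one, and `(n - 1) + (λ_i + 1)` is the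
      -- label `λ_i - 1 + (n + 1)`.
      · rw [neg_mul, mul_neg, ← Units.val_mul, ← Units.val_mul]
        change _ = -((_ * (D i ^ (C.h i a.wt + 1) * B₀.cm i a.wt)⁻¹ : kˣ) : k)
        rw [mul_inv, ← zpow_neg, ← mul_assoc, ← zpow_add, mul_comm]
        congr 4
        omega

/-- The mirror image of `cwFake`, with `λ_i` replaced by `-λ_i` and the roles of `c⁺` and `c⁻`
exchanged. -/
theorem ccwFake (B₀ : BubbleParams k I X) (i : I) (a : Wt C) (n : ℕ)
    (hn : -C.h i a.wt - 1 + n < 0) :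
    ScalesTo Q B D (Tm.ccwFake B₀ i a n) (Tm.ccwFake (B₀.rescale C D) i a n)
      (D i ^ (-C.h i a.wt - 1 + n)) := by
  induction n using Nat.strong_induction_on with
  | _ n ih =>
    cases n with
    | zero =>
      rw [Tm.ccwFake, Tm.ccwFake]
      refine (id _).smul ?_
      rw [Units.val_one, mul_one, ← Units.val_mul]
      change _ = ((_ * (D i ^ (C.h i a.wt + 1) * B₀.cm i a.wt) : kˣ) : k)
      rw [← mul_assoc, ← zpow_add]
      simp
    | succ n =>
      rw [Tm.ccwFake, Tm.ccwFake]
      refine smul (x := D i ^ (n - 1 : ℤ)) (listSum _ fun y _ => ?_) ?_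
      · have hy := y.isLt
        refine ((cwDots _ _ _).comp (ih (n - y.val) (by omega) (by omega))).cast ?_
        rw [← zpow_natCast, ← zpow_add]
        congr 1
        omega
      · rw [neg_mul, mul_neg, ← Units.val_mul, ← Units.val_mul]
        change _ = -((_ * (D i ^ (-C.h i a.wt + 1) * B₀.cp i a.wt)⁻¹ : kˣ) : k)
        rw [mul_inv, ← zpow_neg, ← mul_assoc, ← zpow_add, mul_comm]
        congr 4
        omega

/-- Real and fake bubbles obey one formula. For a real bubble the label counts dots; for a fake one
of degree `2 n` it is `λ_i - 1 + n`, the exponent in `cwFake`. Labels below `λ_i - 1` in the fake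
range give zero, which has every factor. -/
theorem cw (B₀ : BubbleParams k I X) (i : I) (a : Wt C) (m : ℤ) :
    ScalesTo Q B D (Tm.cw B₀ i a m) (Tm.cw (B₀.rescale C D) i a m) (D i ^ m) := by
  unfold Tm.cw
  split_ifs with h h'
  · exact (cwDots _ _ _).cast (by rw [← zpow_natCast, Int.toNat_of_nonneg h])
  · exact (cwFake _ _ _ _ (by omega)).cast (congrArg (D i ^ ·) (by omega))
  · exact zero _ _ _

theorem ccw (B₀ : BubbleParams k I X) (i : I) (a : Wt C) (m : ℤ) :
    ScalesTo Q B D (Tm.ccw B₀ i a m) (Tm.ccw (B₀.rescale C D) i a m) (D i ^ m) := by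
  unfold Tm.ccw
  split_ifs with h h'
  · exact (ccwDots _ _ _).cast (by rw [← zpow_natCast, Int.toNat_of_nonneg h])
  · exact (ccwFake _ _ _ _ (by omega)).cast (congrArg (D i ^ ·) (by omega))
  · exact zero _ _ _

/-- With `f₁ + f₂ + f₃ = λ_i - 1`, dots and bubble label contribute the exponent `f₁ + (-λ_i - 1 +
f₂) + f₃ = -2`. It is the same for all summands, and the same as for two `ii`-crossings. -/
theorem sumEF (B₀ : BubbleParams k I X) (i : I) (h : a.wt + C.α i = b.wt) :
    ScalesTo Q B D (Tm.sumEF B₀ i h) (Tm.sumEF (B₀.rescale C D) i h) (D i ^ (-2 : ℤ)) := by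
  unfold Tm.sumEF
  split_ifs with h0
  · refine listSum _ fun f hf => ?_
    -- The sum is prescribed as a `toNat`; by `h0` this is `λ_i - 1` itself.
    rw [List.Nat.mem_antidiagonalTuple, Fin.sum_univ_three] at hf
    refine (((dots _ _ _).wl _).comp ((capEF _ _).comp ((ccw _ _ _ _).comp ((cupEF _ _).comp
      ((dots _ _ _).wl _))))).cast ?_
    rw [one_mul, one_mul, ← zpow_natCast, ← zpow_natCast, ← zpow_add, ← zpow_add]
    congr 1
    omega
  · exact zero _ _ _

theorem sumFE (B₀ : BubbleParams k I X) (i : I) (h : a.wt + C.α i = b.wt) :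
    ScalesTo Q B D (Tm.sumFE B₀ i h) (Tm.sumFE (B₀.rescale C D) i h) (D i ^ (-2 : ℤ)) := by
  unfold Tm.sumFE
  split_ifs with h0
  · refine listSum _ fun f hf => ?_
    rw [List.Nat.mem_antidiagonalTuple, Fin.sum_univ_three] at hf
    refine (((dots _ _ _).wr _).comp ((capFE _ _).comp ((cw _ _ _ _).comp ((cupFE _ _).comp
      ((dots _ _ _).wr _))))).cast ?_
    rw [one_mul, one_mul, ← zpow_natCast, ← zpow_natCast, ← zpow_add, ← zpow_add]
    congr 1
    omega
  · exact zero _ _ _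

end ScalesTo

end Rescaling

/-! ### Preservation of the defining relations and invertibility -/

section RescalingRel

variable {k : Type w} [CommRing k] {I : Type u} {X : Type v} [AddCommGroup X]
  {C : CartanDatum I X}

namespace ScalesTo

/-- For each relation, both sides are given one factor and `cong` applies. Relations without
parameters need only a count of generators; the others show where the exponents in the rescaled
parameters come from. -/
theorem cong_of_rel (Q : Scalars k C) (B : BubbleParams k I X) (D : I → kˣ)
    ⦃a b : Wt C⦄ ⦃f g : a ⟶ b⦄ {s r : Tm k f g} (h : Rel Q B s r) :
    (pres (Q.rescale D) (B.rescale C D)).Cong (s.lift (Gen.rescale D))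
      (r.lift (Gen.rescale D)) := by
  -- For the `sl₂` relations: the identity has factor 1 and the terms multiplied by `β` have factor
  -- `D_i⁻²`, so the new `β` has to be `D_i⁻² β`.
  have hβ (i : I) (x : X) : (B.β i x : k) * ((D i ^ (-2 : ℤ) : kˣ) : k) =
      ((1 : kˣ) : k) * ((B.rescale C D).β i x : k) := by
    change _ = _ * ((D i ^ (-2 : ℤ) * B.β i x : kˣ) : k)
    rw [Units.val_one, one_mul, Units.val_mul, mul_comm]
  have ht0 {i j : I} (hij : i ≠ j) (h0 : C.h i (C.α j) = 0) :
      (Q.rescale D).t i j hij = Q.t i j hij := if_neg (by omega)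
  have ht1 {i j : I} (hij : i ≠ j) (h1 : C.h i (C.α j) = -1) :
      (Q.rescale D).t i j hij = D i * Q.t i j hij := if_pos h1
  cases h with
  | zigzag₁ i h =>
    exact cong (((id _).vert (((cupFE _ _).wr _).vert (((capEF _ _).wl _).vert (id _)))).cast
      (by simp only [mul_one])) (id _) (.zigzag₁ i h)
  | zigzag₂ i h =>
    exact cong (((id _).vert (((cupFE _ _).wl _).vert (((capEF _ _).wr _).vert (id _)))).cast
      (by simp only [mul_one])) (id _) (.zigzag₂ i h)
  | zigzag₃ i h =>
    exact cong (((id _).vert (((cupEF _ _).wl _).vert (((capFE _ _).wr _).vert (id _)))).cast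
      (by simp only [mul_one])) (id _) (.zigzag₃ i h)
  | zigzag₄ i h =>
    exact cong (((id _).vert (((cupEF _ _).wr _).vert (((capFE _ _).wl _).vert (id _)))).cast
      (by simp only [mul_one])) (id _) (.zigzag₄ i h)
  | dot_cyclic i h =>
    exact cong
      ((id _).vert (((cupFE _ _).wl _).vert ((((dot _ _).wr _).wl _).vert
        (((capEF _ _).wr _).vert (id _)))))
      ((id _).vert (((cupEF _ _).wr _).vert ((((dot _ _).wr _).wl _).vert
        (((capFE _ _).wl _).vert (id _)))))
      (.dot_cyclic i h)
  | cross_cyclic i j hj hi hi' hj' =>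
    exact cong
      ((id _).vert (((cupFE _ _).wl _).vert ((((cupFE _ _).wr _).wl _).vert
        ((((cross _ _).wr _).wl _).vert ((((capEF _ _).wr _).wl _).vert
          (((capEF _ _).wr _).vert (id _)))))))
      ((id _).vert (((cupEF _ _).wr _).vert ((((cupEF _ _).wr _).wl _).vert
        ((((cross _ _).wr _).wl _).vert ((((capFE _ _).wr _).wl _).vert
          (((capFE _ _).wl _).vert (id _)))))))
      (.cross_cyclic i j hj hi hi' hj')
  | quad_self i h h' =>
    exact cong ((cross_self _).comp (cross_self _)) (zero _ _ _) (.quad_self i h h')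
  | quad_zero i j hij hj hi hi' hj' ha =>
    exact cong ((cross_ne hij).comp (cross_ne hij.symm))
      ((id _).smul (by rw [ht0 hij ha, mul_comm, mul_one]))
      (.quad_zero i j hij hj hi hi' hj' ha)
  | quad_neg_one i j hij hj hi hi' hj' ha =>
    -- The relation contains both `t_ij` and `t_ji`. By symmetry of the Cartan integers both are
    -- rescaled, each by the factor of the dot next to it.
    have ha' := (C.h_α_symm j i).trans ha
    refine cong ((cross_ne hij).comp (cross_ne hij.symm))
      ((((dot _ _).wl _).smul ?_).plus (((dot _ _).wr _).smul ?_))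
      (.quad_neg_one i j hij hj hi hi' hj' ha)
    · rw [ht1 hij ha, one_mul, Units.val_one, one_mul, Units.val_mul, mul_comm]
    · rw [ht1 hij.symm ha', one_mul, Units.val_one, one_mul, Units.val_mul, mul_comm]
  | nil_left i h h' =>
    exact cong
      (((((dot _ _).wl _).comp (cross_self _)).cast (mul_inv_cancel _)).diff
        (((cross_self _).comp ((dot _ _).wr _)).cast (inv_mul_cancel _)))
      (id _) (.nil_left i h h')
  | nil_right i h h' =>
    exact cong
      ((((cross_self _).comp ((dot _ _).wl _)).cast (inv_mul_cancel _)).diff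
        ((((dot _ _).wr _).comp (cross_self _)).cast (mul_inv_cancel _)))
      (id _) (.nil_right i h h')
  | slide_left i j hij hj hi hi' hj' =>
    exact cong (((dot _ _).wl _).comp (cross_ne hij))
      (((cross_ne hij).comp ((dot _ _).wr _)).cast (mul_comm _ _))
      (.slide_left i j hij hj hi hi' hj')
  | slide_right i j hij hj hi hi' hj' =>
    exact cong (((dot _ _).wr _).comp (cross_ne hij))
      (((cross_ne hij).comp ((dot _ _).wl _)).cast (mul_comm _ _))
      (.slide_right i j hij hj hi hi' hj')
  | cubic i j l hai haj hal hij hil hji hjl hli hlj hijl hilj hjli hne =>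
    -- The two sides contain crossings with the same three pairs of labels in opposite order, so the
    -- factors differ by commutativity only.
    exact cong
      (((cross _ _).wl _).vert (((cross _ _).wr _).vert ((cross _ _).wl _)))
      (((id _).vert ((((cross _ _).wr _).vert (((cross _ _).wl _).vert
        ((cross _ _).wr _))).vert (id _))).cast
          (by simp only [one_mul, mul_comm, mul_left_comm]))
      (.cubic i j l hai haj hal hij hil hji hjl hli hlj hijl hilj hjli hne)
  | cubic_neg_one i j hne hai haj hii hij hji hiji hiij ha =>
    -- Each side of the braid contains exactly one `ii`-crossing, and `t_ij = D_i⁻¹ (D_i t_ij)`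
    -- gives the identity term the same factor.
    refine cong (x := (D i)⁻¹)
      (((((cross_ne hne).wl _).vert (((cross_self _).wr _).vert
          ((cross_ne hne.symm).wl _))).cast (by simp only [one_mul, mul_one])).diff
        (((id _).vert ((((cross_ne hne.symm).wr _).vert (((cross_self _).wl _).vert
          ((cross_ne hne).wr _))).vert (id _))).cast (by simp only [one_mul, mul_one])))
      ((id _).smul ?_)
      (.cubic_neg_one i j hne hai haj hii hij hji hiji hiij ha)
    rw [ht1 hne ha, Units.val_mul, Units.inv_mul_cancel_left, Units.val_one, mul_one]
  | mixed_EF i j hne hi hj hj' hi' =>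
    exact cong (((sideEF (cross_ne hne.symm)).comp (sideFE (cross_ne hne))).cast (mul_one _))
      (id _) (.mixed_EF i j hne hi hj hj' hi')
  | mixed_FE i j hne hi hj hj' hi' =>
    exact cong (((sideFE (cross_ne hne)).comp (sideEF (cross_ne hne.symm))).cast (mul_one _))
      (id _) (.mixed_FE i j hne hi hj hj' hi')
  | cw_neg i a m hm => exact cong (cwDots _ _ _) (zero _ _ _) (.cw_neg i a m hm)
  | ccw_neg i a m hm => exact cong (ccwDots _ _ _) (zero _ _ _) (.ccw_neg i a m hm)
  | cw_zero i a m hm =>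
    refine cong (cwDots _ _ _) ((id _).smul ?_) (.cw_zero i a m hm)
    rw [Units.val_one, mul_one, ← Units.val_mul]
    change _ = ((_ * (D i ^ (-C.h i a.wt + 1) * B.cp i a.wt) : kˣ) : k)
    -- The bubble has `m = λ_i - 1` dots, and `D_i^(λ_i - 1)` cancels the power in the new `c⁺`.
    rw [← zpow_natCast, hm, ← mul_assoc, ← zpow_add]
    simp
  | ccw_zero i a m hm =>
    refine cong (ccwDots _ _ _) ((id _).smul ?_) (.ccw_zero i a m hm)
    rw [Units.val_one, mul_one, ← Units.val_mul]
    change _ = ((_ * (D i ^ (C.h i a.wt + 1) * B.cm i a.wt) : kˣ) : k)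
    rw [← zpow_natCast, hm, ← mul_assoc, ← zpow_add]
    simp
  | grassmannian i a n =>
    -- The labels `λ_i - 1 + x` and `-λ_i - 1 + y` have sum `n - 2`. On the right only `n = 0`
    -- matters, where `D_i⁻²` cancels the `D_i²` in the inverse of the new `β`.
    refine cong (x := D i ^ (n - 2 : ℤ)) (listSum _ fun p hp => ?_) ((id _).smul ?_)
      (.grassmannian i a n)
    · rw [List.Nat.mem_antidiagonal] at hp
      refine ((cw _ _ _ _).comp (ccw _ _ _ _)).cast ?_
      rw [← zpow_add]
      congr 1
      omega
    · split_ifs with h0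
      · subst h0
        rw [Units.val_one, mul_one, mul_neg, ← Units.val_mul]
        change _ = -((_ * (D i ^ (-2 : ℤ) * B.β i a.wt)⁻¹ : kˣ) : k)
        rw [mul_inv, ← zpow_neg, ← mul_assoc, ← zpow_add]
        simp
      · rw [zero_mul, mul_zero]
  | sl2_EF i h h' =>
    refine cong (id _) (diff (smul (x := D i ^ (-2 : ℤ)) ?_ (hβ _ _))
        ((sumEF _ _ _).smul (hβ _ _))) (.sl2_EF i h h')
    exact ((sideEF (cross_self _)).comp (sideFE (cross_self _))).cast (by
      rw [← mul_inv, zpow_neg, zpow_two])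
  | sl2_FE i h h' =>
    refine cong (id _) (diff (smul (x := D i ^ (-2 : ℤ)) ?_ (hβ _ _))
        ((sumFE _ _ _).smul (hβ _ _))) (.sl2_FE i h h')
    exact ((sideFE (cross_self _)).comp (sideEF (cross_self _))).cast (by
      rw [← mul_inv, zpow_neg, zpow_two])

end ScalesTo

/-- Rescaling the generators is a morphism of presentations. -/
noncomputable def rescaleHom {Q Q' : Scalars k C} {B B' : BubbleParams k I X} (D : I → kˣ)
    (hQ : Q' = Q.rescale D) (hB : B' = B.rescale C D) : (pres Q B).Hom (pres Q' B') where
  gen := Gen.rescale D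
  hasDeg _ _ _ _ x := .smul _ (.gen x)
  rel _ _ _ _ _ _ h := by subst hQ hB; exact ScalesTo.cong_of_rel Q B D h

theorem Gen.factor_inv (D : I → kˣ) ⦃a b : Wt C⦄ ⦃f g : a ⟶ b⦄ (x : Gen C f g) :
    x.factor D⁻¹ = (x.factor D)⁻¹ := by
  cases x with
  | cross i j => by_cases h : i = j <;> simp [Gen.factor, h]
  | _ => simp [Gen.factor]

/-- Doubly rescaled parameters equal the original ones only propositionally. With these equalities
as hypotheses, the inverse lands in `U Q B` itself and one statement covers both orders of
composition. -/
theorem rescaleHom_strict_comp {Q Q' : Scalars k C} {B B' : BubbleParams k I X} {D D' : I → kˣ}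
    (hQ : Q' = Q.rescale D) (hB : B' = B.rescale C D) (hQ' : Q = Q'.rescale D')
    (hB' : B = B'.rescale C D') (hD : D' = D⁻¹) :
    (rescaleHom D hQ hB).strict.comp (rescaleHom D' hQ' hB').strict =
      StrictPseudofunctor.id (U Q B) := by
  refine Presentation.Hom.strict_comp_strict _ _ fun a b f g x => ?_
  subst hD
  have h : (Gen.factor D x : k) * (Gen.factor D⁻¹ x : k) = 1 := by
    rw [← Units.val_mul, ← Units.val_one]
    exact congrArg _ (mul_eq_one_iff_eq_inv'.2 (Gen.factor_inv D x))
  refine .trans (.symm (.mul_smul _ _ _)) ?_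
  exact h ▸ .one_smul _

/-- Transfers a factor computed on formal expressions to the 2-functor. The expressions `s` and `s'`
may differ, as they do for fake bubbles. -/
theorem env_ofTerm {Q Q' : Scalars k C} {B B' : BubbleParams k I X} {D : I → kˣ}
    {hQ : Q' = Q.rescale D} {hB : B' = B.rescale C D} {a b : Wt C} {f g : a ⟶ b}
    {s s' : Tm k f g} {x : kˣ} (hs : ScalesTo Q' B' D s s' x) {d : ℤ} (h : s.HasDeg Gen.deg d)
    (h' : s'.HasDeg Gen.deg d) :
    (rescaleHom D hQ hB).env (Presentation.Env.ofTerm (T := pres Q B) s h) =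
      (x : k) • Presentation.Env.ofTerm (T := pres Q' B') s' h' :=
  Presentation.Env.TwoMor.ext (funext fun _ => funext fun _ => Presentation.Star.sound hs)

theorem env_gen2 {Q Q' : Scalars k C} {B B' : BubbleParams k I X} {D : I → kˣ}
    {hQ : Q' = Q.rescale D} {hB : B' = B.rescale C D} {a b : Wt C} {f g : a ⟶ b} (x : Gen C f g) :
    (rescaleHom D hQ hB).env (gen2 Q B x) = (x.factor D : k) • gen2 Q' B' x :=
  env_ofTerm (.gen x) _ _

end RescalingRel
end CatQG

/-! ### The isomorphism of 2-categories -/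

theorem mainTheorem3 {k : Type*} [Field k] {I X : Type*} [AddCommGroup X] [Module.Free ℤ X]
    (C : CatQG.CartanDatum I X) (Q : CatQG.Scalars k C) (B : CatQG.BubbleParams k I X)
    (hQB : CatQG.Compatible Q B) (D : I → kˣ) :
    CatQG.Compatible (Q.rescale D) (B.rescale C D) ∧
    ∃ (beth : StrictPseudofunctor (CatQG.U Q B) (CatQG.U (Q.rescale D) (B.rescale C D)))
      (bethInv : StrictPseudofunctor (CatQG.U (Q.rescale D) (B.rescale C D)) (CatQG.U Q B)),
      beth.comp bethInv = StrictPseudofunctor.id (CatQG.U Q B) ∧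
      bethInv.comp beth = StrictPseudofunctor.id (CatQG.U (Q.rescale D) (B.rescale C D)) ∧
      ∃ φ : ∀ {a b : CatQG.U Q B} {x y : a ⟶ b}, (x ⟶ y) →
          ((CatQG.Presentation.Env.idOne (CatQG.pres Q B)
              (CatQG.pres (Q.rescale D) (B.rescale C D))).map x ⟶
            (CatQG.Presentation.Env.idOne (CatQG.pres Q B)
              (CatQG.pres (Q.rescale D) (B.rescale C D))).map y),
        beth.toPrelaxFunctorStruct =
          { toPrefunctor := CatQG.Presentation.Env.idOne (CatQG.pres Q B)
              (CatQG.pres (Q.rescale D) (B.rescale C D))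
            map₂ := φ } ∧
        (∀ {a b : CatQG.U Q B} {x y : a ⟶ b} (s r : x ⟶ y), φ (s + r) = φ s + φ r) ∧
        (∀ {a b : CatQG.U Q B} {x y : a ⟶ b} (c : k) (s : x ⟶ y), φ (c • s) = c • φ s) ∧
        (∀ {a b : CatQG.U Q B} {x y : a ⟶ b} (s : x ⟶ y) (n : ℤ),
          φ (CatQG.Presentation.Env.shiftHom s n) = CatQG.Presentation.Env.shiftHom (φ s) n) ∧
        (∀ {a b : CatQG.Wt C} (i : I) (h : a.wt + C.α i = b.wt),
          φ (CatQG.gen2 Q B (.dot i h)) =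
            (D i : k) • CatQG.gen2 (Q.rescale D) (B.rescale C D) (.dot i h)) ∧
        (∀ {a b c d : CatQG.Wt C} (i : I) (h₁ : a.wt + C.α i = b.wt) (h₂ : b.wt + C.α i = d.wt)
            (h₃ : a.wt + C.α i = c.wt) (h₄ : c.wt + C.α i = d.wt),
          φ (CatQG.gen2 Q B (.cross i i h₁ h₂ h₃ h₄)) =
            (D i : k)⁻¹ •
              CatQG.gen2 (Q.rescale D) (B.rescale C D) (.cross i i h₁ h₂ h₃ h₄)) ∧
        (∀ {a b c d : CatQG.Wt C} (i j : I) (_ : i ≠ j) (h₁ : a.wt + C.α j = b.wt)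
            (h₂ : b.wt + C.α i = d.wt) (h₃ : a.wt + C.α i = c.wt) (h₄ : c.wt + C.α j = d.wt),
          φ (CatQG.gen2 Q B (.cross i j h₁ h₂ h₃ h₄)) =
            CatQG.gen2 (Q.rescale D) (B.rescale C D) (.cross i j h₁ h₂ h₃ h₄)) ∧
        (∀ {a b : CatQG.Wt C} (i : I) (h : a.wt + C.α i = b.wt),
          φ (CatQG.gen2 Q B (.cupFE i h)) =
              CatQG.gen2 (Q.rescale D) (B.rescale C D) (.cupFE i h) ∧
          φ (CatQG.gen2 Q B (.cupEF i h)) =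
              CatQG.gen2 (Q.rescale D) (B.rescale C D) (.cupEF i h) ∧
          φ (CatQG.gen2 Q B (.capFE i h)) =
              CatQG.gen2 (Q.rescale D) (B.rescale C D) (.capFE i h) ∧
          φ (CatQG.gen2 Q B (.capEF i h)) =
              CatQG.gen2 (Q.rescale D) (B.rescale C D) (.capEF i h)) ∧
        (∀ (i : I) (a : CatQG.Wt C) (m d : ℤ)
            (h : (CatQG.Tm.cw (C := C) B i a m).HasDeg CatQG.Gen.deg d)
            (h' : (CatQG.Tm.cw (C := C) (B.rescale C D) i a m).HasDeg CatQG.Gen.deg d),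
          φ (CatQG.Presentation.Env.ofTerm (T := CatQG.pres Q B) _ h) =
            ((D i : k) ^ m) • CatQG.Presentation.Env.ofTerm
              (T := CatQG.pres (Q.rescale D) (B.rescale C D)) _ h') ∧
        (∀ (i : I) (a : CatQG.Wt C) (m d : ℤ)
            (h : (CatQG.Tm.ccw (C := C) B i a m).HasDeg CatQG.Gen.deg d)
            (h' : (CatQG.Tm.ccw (C := C) (B.rescale C D) i a m).HasDeg CatQG.Gen.deg d),
          φ (CatQG.Presentation.Env.ofTerm (T := CatQG.pres Q B) _ h) =
            ((D i : k) ^ m) • CatQG.Presentation.Env.ofTerm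
              (T := CatQG.pres (Q.rescale D) (B.rescale C D)) _ h') := by
  refine ⟨hQB.rescale D, ?_⟩
  have hQ : Q = (Q.rescale D).rescale D⁻¹ := (Q.rescale_rescale_inv D).symm
  have hB : B = (B.rescale C D).rescale C D⁻¹ := (B.rescale_rescale_inv C D).symm
  let F := CatQG.rescaleHom (Q := Q) (B := B) D rfl rfl
  let F' := CatQG.rescaleHom D⁻¹ hQ hB
  have hF {a b : CatQG.Wt C} {f g : a ⟶ b} (x : CatQG.Gen C f g) :
      F.env (CatQG.gen2 Q B x) =
        (x.factor D : k) • CatQG.gen2 (Q.rescale D) (B.rescale C D) x := CatQG.env_gen2 x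
  have hF₁ {a b : CatQG.Wt C} {f g : a ⟶ b} (x : CatQG.Gen C f g) (hx : x.factor D = 1) :
      F.env (CatQG.gen2 Q B x) = CatQG.gen2 (Q.rescale D) (B.rescale C D) x := by
    rw [hF, hx, Units.val_one, one_smul]
  refine ⟨F.strict, F'.strict, CatQG.rescaleHom_strict_comp _ _ _ _ rfl,
    -- For the composite in the other order the roles of `D` and `D⁻¹` are exchanged.
    CatQG.rescaleHom_strict_comp _ _ _ _ (inv_inv D).symm, F.env, F.strict_toPrelaxFunctorStruct,
    -- Grading shifts change only the degrees, not the matrix entries, so compatibility with them is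
    -- definitional.
    F.env_add, F.env_smul, fun s n => rfl, fun i h => hF _, fun i h₁ h₂ h₃ h₄ => ?_,
    fun i j hij h₁ h₂ h₃ h₄ => hF₁ _ (if_neg hij),
    fun i h => ⟨hF₁ _ rfl, hF₁ _ rfl, hF₁ _ rfl, hF₁ _ rfl⟩, fun i a m d h h' => ?_,
    fun i a m d h h' => ?_⟩
  · rw [← Units.val_inv_eq_inv_val]
    exact (hF _).trans (congrArg (fun c : kˣ => (c : k) • _) (if_pos rfl))
  · rw [← Units.val_zpow_eq_zpow_val]
    exact CatQG.env_ofTerm (.cw B i a m) h h'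
  · rw [← Units.val_zpow_eq_zpow_val]
    exact CatQG.env_ofTerm (.ccw B i a m) h h'
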